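/- Let $M,N\ge 1$ be integers, let $\lambda_S,\lambda_R,\mu\ge 0$, and let $\nu$ be a Borel probability measure on $[-\pi,\pi]$ (that is, on the circle) such that $$\int_{-\pi}^{\pi}\nu(d\theta)\,\sin\theta\cos\theta=0 .$$ Write points of $\mathbb R^{M+N}$ as $\mathbf x=(\mathbf v,\mathbf w)$ with $\mathbf v\in\mathbb R^M$ (system) and $\mathbf w\in\mathbb R^N$ (reservoir). For $1\le i<j\le M+N$ let $r_{ij}(\theta)^{-1}\mathbf x$ be the vector obtained from $\mathbf x$ by replacing $x_i$ with $x_i\cos\theta-x_j\sin\theta$ and $x_j$ with $x_i\sin\theta+x_j\cos\theta$, and let $R_{ij}$ be the bounded operator on $L^1(\mathbb R^{M+N})$ $$(R_{ij}F)(\mathbf x)=\int_{-\pi}^{\pi}F\big(r_{ij}(\theta)^{-1}\mathbf x\big)\,\nu(d\theta).$$ Let $$\mathcal L=\frac{\lambda_S}{M-1}\sum_{1\le i<j\le M}(R_{ij}-I)+\frac{\lambda_R}{N-1}\sum_{M<i<j\le M+N}(R_{ij}-I)+\frac{\mu}{N}\sum_{i=1}^{M}\sum_{j=M+1}^{M+N}(R_{ij}-I),$$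 where the first sum is absent if $M=1$ and the second if $N=1$. Let $f_0$ be a probability density on $\mathbb R^M$ with respect to Lebesgue measure, let $F_0(\mathbf v,\mathbf w)=f_0(\mathbf v)e^{-\pi|\mathbf w|^2}$, and for $t\ge 0$ let $$f(\mathbf v,t)=\int_{\mathbb R^N}\big[e^{t\mathcal L}F_0\big](\mathbf v,\mathbf w)\,d\mathbf w$$ be the marginal on the system of the solution of $\partial_tF=\mathcal LF$, $F(0)=F_0$. For a probability density $f$ on $\mathbb R^M$ let $$\widetilde S(f)=\int_{\mathbb R^M}f(\mathbf v)\log\frac{f(\mathbf v)}{e^{-\pi|\mathbf v|^2}}\,d\mathbf v\in[0,+\infty]$$ be its entropy relative to the Maxwellian. Then for every $t\ge 0$ $$\widetilde S(f(\cdot,t))\le\left[\frac{M}{N+M}+\frac{N}{N+M}\,e^{-t\mu_\nu(N+M)/N}\right]\widetilde S(f_0),\qquad \mu_\nu=\mu\int_{-\pi}^{\pi}\nu(d\theta)\,\sin^2\theta .$$ -/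

import Mathlib

open MeasureTheory

noncomputable section

namespace Kac

section Collision

variable {ι : Type*} [Fintype ι] [DecidableEq ι]

/-- The rotation `r_{ij}(θ)⁻¹` of the velocities: it sends `x` to the vector whose `i`-th coordinate
is `x i cos θ - x j sin θ`, whose `j`-th coordinate is `x i sin θ + x j cos θ`, and whose other
coordinates are those of `x`. -/
def rotInv (i j : ι) (θ : ℝ) (x : ι → ℝ) : ι → ℝ := fun k =>
  if k = i then x i * Real.cos θ - x j * Real.sin θ
  else if k = j then x i * Real.sin θ + x j * Real.cos θ
  else x k

lemma sum_sq_rotInv {i j : ι} (hij : i ≠ j) (θ : ℝ) (x : ι → ℝ) :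
    ∑ k, rotInv i j θ x k ^ 2 = ∑ k, x k ^ 2 := by
  have h : ∑ k ∈ ({i, j} : Finset ι), (rotInv i j θ x k ^ 2 - x k ^ 2)
      = ∑ k, (rotInv i j θ x k ^ 2 - x k ^ 2) := by
    refine Finset.sum_subset (Finset.subset_univ _) fun k _ hk => ?_
    simp only [Finset.mem_insert, Finset.mem_singleton, not_or] at hk
    simp [rotInv, hk.1, hk.2]
  rw [Finset.sum_pair hij, Finset.sum_sub_distrib] at h
  simp only [rotInv, if_true, hij.symm, if_false] at h
  have := Real.sin_sq_add_cos_sq θ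
  rw [← sub_eq_zero, ← Finset.sum_sub_distrib]
  simp only [Finset.sum_sub_distrib, rotInv]
  rw [← h]
  linear_combination (x i ^ 2 + x j ^ 2) * this

/-- The rotation as a linear map of Euclidean space. -/
def rotInvLin (i j : ι) (θ : ℝ) : EuclideanSpace ℝ ι →ₗ[ℝ] EuclideanSpace ℝ ι where
  toFun x := WithLp.toLp 2 (rotInv i j θ x.ofLp)
  map_add' x y := by
    ext k
    simp only [rotInv, PiLp.add_apply]
    split_ifs <;> ring
  map_smul' c x := by
    ext k
    simp only [rotInv, PiLp.smul_apply, smul_eq_mul, RingHom.id_apply]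
    split_ifs <;> ring

lemma measurePreserving_rotInv {i j : ι} (hij : i ≠ j) (θ : ℝ) :
    MeasurePreserving (rotInv i j θ) (volume : Measure (ι → ℝ)) volume := by
  let e : EuclideanSpace ℝ ι →ₗᵢ[ℝ] EuclideanSpace ℝ ι :=
    { rotInvLin i j θ with
      norm_map' := fun x => by
        rw [EuclideanSpace.norm_eq, EuclideanSpace.norm_eq]
        congr 1
        simpa [rotInvLin] using sum_sq_rotInv hij θ x.ofLp }
  have h := (e.toLinearIsometryEquiv rfl).measurePreserving
  exact (PiLp.volume_preserving_ofLp ι).comp (h.comp (PiLp.volume_preserving_toLp ι))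

lemma measurable_rotInv {κ : Type*} [DecidableEq κ] (i j : κ) :
    Measurable (Function.uncurry (rotInv i j)) := by
  refine measurable_pi_lambda _ fun k => ?_
  simp only [Function.uncurry, rotInv]
  split_ifs <;> fun_prop

variable (ν : Measure ℝ) [IsProbabilityMeasure ν]

lemma measurePreserving_skew {i j : ι} (hij : i ≠ j) :
    MeasurePreserving (fun p : ℝ × (ι → ℝ) => (p.1, rotInv i j p.1 p.2))
      (ν.prod volume) (ν.prod volume) :=
  (MeasurePreserving.id ν).skew_product (measurable_rotInv i j)
    (Filter.Eventually.of_forall fun θ => (measurePreserving_rotInv hij θ).map_eq)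

lemma measurePreserving_snd_skew {i j : ι} (hij : i ≠ j) :
    MeasurePreserving (fun p : ℝ × (ι → ℝ) => rotInv i j p.1 p.2) (ν.prod volume) volume :=
  measurePreserving_snd.comp (measurePreserving_skew ν hij)

/-- The collision average `(R_{ij} F)(x) = ∫ F(r_{ij}(θ)⁻¹ x) ν(dθ)`. -/
def collisionFun (i j : ι) (F : (ι → ℝ) → ℝ) : (ι → ℝ) → ℝ :=
  fun x => ∫ θ, F (rotInv i j θ x) ∂ν

lemma integrable_skew {i j : ι} (hij : i ≠ j) {F : (ι → ℝ) → ℝ} (hF : Integrable F) :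
    Integrable (fun p : ℝ × (ι → ℝ) => F (rotInv i j p.1 p.2)) (ν.prod volume) :=
  (measurePreserving_snd_skew ν hij).integrable_comp_of_integrable hF

lemma integrable_collisionFun {i j : ι} (hij : i ≠ j) {F : (ι → ℝ) → ℝ} (hF : Integrable F) :
    Integrable (collisionFun ν i j F) :=
  (integrable_skew ν hij hF).integral_prod_right

lemma collisionFun_congr {i j : ι} (hij : i ≠ j) {F G : (ι → ℝ) → ℝ} (h : F =ᵐ[volume] G) :
    collisionFun ν i j F =ᵐ[volume] collisionFun ν i j G := by
  have h1 : ∀ᵐ p ∂((volume : Measure (ι → ℝ)).prod ν),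
      F (rotInv i j p.2 p.1) = G (rotInv i j p.2 p.1) :=
    (Measure.measurePreserving_swap (μ := (volume : Measure (ι → ℝ)))
      (ν := ν)).quasiMeasurePreserving.ae
      ((measurePreserving_snd_skew ν hij).quasiMeasurePreserving.ae h)
  filter_upwards [Measure.ae_ae_of_ae_prod h1] with x hx
  exact integral_congr_ae hx

lemma collisionFun_add {i j : ι} (hij : i ≠ j) {F G : (ι → ℝ) → ℝ}
    (hF : Integrable F) (hG : Integrable G) :
    collisionFun ν i j (F + G) =ᵐ[volume] collisionFun ν i j F + collisionFun ν i j G := by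
  filter_upwards [(integrable_skew ν hij hF).prod_left_ae,
    (integrable_skew ν hij hG).prod_left_ae] with x h1 h2
  exact integral_add h1 h2

lemma integral_abs_collisionFun_le {i j : ι} (hij : i ≠ j) {F : (ι → ℝ) → ℝ}
    (hF : Integrable F) : ∫ x, ‖collisionFun ν i j F x‖ ≤ ∫ x, ‖F x‖ := by
  have h1 := integrable_skew ν hij hF
  calc ∫ x, ‖collisionFun ν i j F x‖
      ≤ ∫ x, ∫ θ, ‖F (rotInv i j θ x)‖ ∂ν :=
        integral_mono (integrable_collisionFun ν hij hF).norm h1.norm.integral_prod_right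
          fun x => norm_integral_le_integral_norm _
    _ = ∫ θ, (∫ x, ‖F (rotInv i j θ x)‖) ∂ν :=
        (integral_integral_swap (f := fun θ x => ‖F (rotInv i j θ x)‖) h1.norm).symm
    _ = ∫ _θ, (∫ x, ‖F x‖) ∂ν := by
        refine integral_congr_ae (Filter.Eventually.of_forall fun θ => ?_)
        have h2 := measurePreserving_rotInv hij θ
        change ∫ x, ‖F (rotInv i j θ x)‖ = ∫ x, ‖F x‖
        conv_rhs => rw [← h2.map_eq]
        rw [integral_map h2.measurable.aemeasurable]
        rw [h2.map_eq]
        exact hF.aestronglyMeasurable.norm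
    _ = ∫ x, ‖F x‖ := by simp

/-- The collision operator `R_{ij}` as a bounded operator on `L¹(ℝ^ι, dx)`. -/
def collision (i j : ι) (hij : i ≠ j) :
    ((ι → ℝ) →₁[volume] ℝ) →L[ℝ] ((ι → ℝ) →₁[volume] ℝ) :=
  LinearMap.mkContinuous
    { toFun := fun F =>
        (integrable_collisionFun ν hij (L1.integrable_coeFn F)).toL1 (collisionFun ν i j F)
      map_add' := fun F G => by
        rw [← Integrable.toL1_add, Integrable.toL1_eq_toL1_iff]
        exact (collisionFun_congr ν hij (Lp.coeFn_add F G)).trans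
          (collisionFun_add ν hij (L1.integrable_coeFn F) (L1.integrable_coeFn G))
      map_smul' := fun c F => by
        rw [RingHom.id_apply, ← Integrable.toL1_smul, Integrable.toL1_eq_toL1_iff]
        refine (collisionFun_congr ν hij (Lp.coeFn_smul c F)).trans
          (Filter.Eventually.of_forall fun x => ?_)
        simp only [collisionFun, Pi.smul_apply]
        exact integral_smul c _ }
    1 fun F => by
      rw [one_mul]
      change ‖(integrable_collisionFun ν hij (L1.integrable_coeFn F)).toL1 _‖ ≤ _
      rw [L1.norm_of_fun_eq_integral_norm, L1.norm_eq_integral_norm]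
      exact integral_abs_collisionFun_le ν hij (L1.integrable_coeFn F)

lemma coeFn_collision (i j : ι) (hij : i ≠ j) (F : (ι → ℝ) →₁[volume] ℝ) :
    collision ν i j hij F =ᵐ[volume] fun x => ∫ θ, F (rotInv i j θ x) ∂ν :=
  Integrable.coeFn_toL1 (integrable_collisionFun ν hij (L1.integrable_coeFn F))

end Collision

/-- The index set of the velocities `(𝐯, 𝐰)`: `Sum.inl` for the `M` particles of the system,
`Sum.inr` for the `N` particles of the reservoir. -/
abbrev Particle (M N : ℕ) : Type := Fin M ⊕ Fin N

/-- `L¹(ℝ^{M+N})` with respect to Lebesgue measure. -/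
abbrev State (M N : ℕ) : Type := (Particle M N → ℝ) →₁[volume] ℝ

/-- The generator of the master equation on `L¹(ℝ^{M+N})`,
`L = λ_S/(M-1) ∑_{i<j in system} (R_{ij} - I) + λ_R/(N-1) ∑_{i<j in reservoir} (R_{ij} - I)
  + μ/N ∑_{i in system, j in reservoir} (R_{ij} - I)`.
For `M = 1` (or `N = 1`) the first (or second) sum is empty. -/
def generator (M N : ℕ) (lamS lamR mu : ℝ) (ν : Measure ℝ) [IsProbabilityMeasure ν] :
    State M N →L[ℝ] State M N :=
  (lamS / ((M : ℝ) - 1)) • ∑ p : {p : Fin M × Fin M // p.1 < p.2},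
      (collision ν (Sum.inl p.1.1 : Particle M N) (Sum.inl p.1.2)
        (fun h => p.2.ne (Sum.inl.inj h)) - ContinuousLinearMap.id ℝ (State M N))
  + (lamR / ((N : ℝ) - 1)) • ∑ p : {p : Fin N × Fin N // p.1 < p.2},
      (collision ν (Sum.inr p.1.1 : Particle M N) (Sum.inr p.1.2)
        (fun h => p.2.ne (Sum.inr.inj h)) - ContinuousLinearMap.id ℝ (State M N))
  + (mu / (N : ℝ)) • ∑ i : Fin M, ∑ j : Fin N,
      (collision ν (Sum.inl i : Particle M N) (Sum.inr j) Sum.inl_ne_inr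
        - ContinuousLinearMap.id ℝ (State M N))

/-- The Kac evolution `e^{tL}` on `L¹(ℝ^{M+N})`. -/
def evolution (M N : ℕ) (lamS lamR mu : ℝ) (ν : Measure ℝ) [IsProbabilityMeasure ν] (t : ℝ) :
    State M N →L[ℝ] State M N :=
  NormedSpace.exp (t • generator M N lamS lamR mu ν)

/-- The Maxwellian `e^{-π|𝐱|²}` on `ℝ^n`, with `|𝐱|` the Euclidean length. -/
def maxwellian {n : ℕ} (x : Fin n → ℝ) : ℝ := Real.exp (-Real.pi * ∑ k, x k ^ 2)

lemma integrable_maxwellian (n : ℕ) : Integrable (maxwellian (n := n)) := by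
  have h : (maxwellian (n := n)) = fun x => ∏ k, Real.exp (-Real.pi * x k ^ 2) := by
    funext x
    rw [maxwellian, Finset.mul_sum, Real.exp_sum]
  rw [h]
  exact Integrable.fintype_prod (f := fun (_ : Fin n) (y : ℝ) => Real.exp (-Real.pi * y ^ 2))
    fun _ => integrable_exp_neg_mul_sq Real.pi_pos

/-- `F₀(𝐯, 𝐰) = f₀(𝐯) e^{-π|𝐰|²}`. -/
def initialFun {M N : ℕ} (f₀ : (Fin M → ℝ) → ℝ) (x : Particle M N → ℝ) : ℝ :=
  f₀ (fun i => x (Sum.inl i)) * maxwellian (fun j => x (Sum.inr j))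

lemma integrable_initialFun {M : ℕ} (N : ℕ) {f₀ : (Fin M → ℝ) → ℝ} (hf : Integrable f₀) :
    Integrable (initialFun f₀ : (Particle M N → ℝ) → ℝ) :=
  (volume_measurePreserving_sumPiEquivProdPi
    (fun _ : Particle M N => ℝ)).integrable_comp_of_integrable
      (hf.mul_prod (integrable_maxwellian N))

/-- The initial state `F₀` as an element of `L¹(ℝ^{M+N})`. -/
def initialState {M : ℕ} (N : ℕ) (f₀ : (Fin M → ℝ) → ℝ) (hf : Integrable f₀) : State M N :=
  (integrable_initialFun N hf).toL1 (initialFun f₀)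

/-- The marginal on the system, `𝐯 ↦ ∫ F(𝐯, 𝐰) d𝐰`. -/
def marginal {M N : ℕ} (F : State M N) : (Fin M → ℝ) → ℝ :=
  fun v => ∫ w : Fin N → ℝ, F (Sum.elim v w)

/-- The entropy of `f` relative to the Maxwellian, `∫ f log (f / e^{-π|𝐯|²}) d𝐯`, as an extended
real number. For a probability density `f` the negative part of the integrand is always
integrable, so that the value is `+∞` when the integrand is not integrable. -/
def relEntropy {M : ℕ} (f : (Fin M → ℝ) → ℝ) : EReal :=
  open Classical in
  if Integrable (fun v => f v * Real.log (f v / maxwellian v)) then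
    ((∫ v, f v * Real.log (f v / maxwellian v) : ℝ) : EReal)
  else ⊤

end Kac

end

/-!
Each collision operator averages over rotations of `ℝ^{M+N}`, so `e^{tL}` averages over a random
orthogonal transformation, whose law is a compound Poisson law on the orthogonal group. The
reservoir starts in the Maxwellian, and the Maxwellian of the whole is invariant; hence the density
`h` of the system marginal relative to the Maxwellian evolves by `(T h)(v) = E[h(A v + B w)]`, where
`A`, `B` are the blocks of the random transformation that land in the system and `w` is Gaussian.

The Ornstein–Uhlenbeck semigroup commutes with `T`, and `∇(T h)(v) = E[A* ∇h(A v + B w)]`. If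
`E|A* ξ|² = q |ξ|²`, the Cauchy–Schwarz inequality bounds the Fisher information of `T h` by `q`
times that of `h`, and integrating along the Ornstein–Uhlenbeck flow gives the same bound for the
entropies. The factor `q` comes from the quadratic form `N |v|² - M |w|²`, which is an eigenfunction
of the generator with eigenvalue `-μ_ν (N + M) / N`, while the energy is conserved.
-/

noncomputable section

namespace Kac

lemma integral_comp_of_measurePreserving {α β G : Type*} [MeasurableSpace α] [MeasurableSpace β]
    [NormedAddCommGroup G] [NormedSpace ℝ G] {μ : Measure α} {ν : Measure β} {g : α → β}
    {f : β → G} (hg : MeasurePreserving g μ ν) (hf : AEStronglyMeasurable f ν) :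
    ∫ x, f (g x) ∂μ = ∫ y, f y ∂ν := by
  rw [← integral_map hg.aemeasurable (hg.map_eq ▸ hf), hg.map_eq]

section Gaussian

open Real InnerProductSpace ProbabilityTheory

variable (E : Type*) [NormedAddCommGroup E] [InnerProductSpace ℝ E] [FiniteDimensional ℝ E]
  [MeasurableSpace E] [BorelSpace E]
variable {F : Type*} [NormedAddCommGroup F] [InnerProductSpace ℝ F] [FiniteDimensional ℝ F]
  [MeasurableSpace F] [BorelSpace F]

/-- The Maxwellian law `e^{-π‖x‖²} dx`, a Gaussian of covariance `(2π)⁻¹`. It is the reference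
measure of all entropies. -/
def gauss : Measure E :=
  volume.withDensity fun x => ENNReal.ofReal (exp (-π * ‖x‖ ^ 2))

variable {E}

lemma integrable_exp_neg_pi_mul_sq_norm : Integrable fun x : E => exp (-π * ‖x‖ ^ 2) := by
  by_contra h
  have h_int := GaussianFourier.integral_rexp_neg_mul_sq_norm (V := E) pi_pos
  rw [integral_undef h, div_self pi_ne_zero, one_rpow] at h_int
  exact zero_ne_one h_int

instance isProbabilityMeasure_gauss : IsProbabilityMeasure (gauss E) where
  measure_univ := by
    rw [gauss, withDensity_apply _ MeasurableSet.univ, setLIntegral_univ,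
      ← ofReal_integral_eq_lintegral_ofReal integrable_exp_neg_pi_mul_sq_norm
        (.of_forall fun _ => (exp_pos _).le),
      GaussianFourier.integral_rexp_neg_mul_sq_norm pi_pos, div_self pi_ne_zero, one_rpow,
      ENNReal.ofReal_one]

lemma integral_gauss {G : Type*} [NormedAddCommGroup G] [NormedSpace ℝ G] (f : E → G) :
    ∫ x, f x ∂gauss E = ∫ x, exp (-π * ‖x‖ ^ 2) • f x := by
  rw [gauss, integral_withDensity_eq_integral_toReal_smul (by fun_prop)
    (.of_forall fun _ => ENNReal.ofReal_lt_top)]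
  simp only [ENNReal.toReal_ofReal (exp_nonneg _)]

lemma integrable_gauss_iff {f : E → ℝ} :
    Integrable f (gauss E) ↔ Integrable fun x => exp (-π * ‖x‖ ^ 2) * f x := by
  rw [gauss, integrable_withDensity_iff_integrable_smul' (by fun_prop)
    (.of_forall fun _ => ENNReal.ofReal_lt_top)]
  simp only [ENNReal.toReal_ofReal (exp_nonneg _), smul_eq_mul]

lemma gauss_absolutelyContinuous : gauss E ≪ volume :=
  withDensity_absolutelyContinuous _ _

lemma absolutelyContinuous_gauss : (volume : Measure E) ≪ gauss E :=
  withDensity_absolutelyContinuous' (by fun_prop) (by simp [exp_pos])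

lemma measurePreserving_gauss_linearIsometryEquiv (e : E ≃ₗᵢ[ℝ] F) :
    MeasurePreserving e (gauss E) (gauss F) := by
  refine ⟨e.continuous.measurable, Measure.ext fun s hs => ?_⟩
  rw [Measure.map_apply e.continuous.measurable hs, gauss, gauss,
    withDensity_apply _ (e.continuous.measurable hs), withDensity_apply _ hs,
    ← e.measurePreserving.setLIntegral_comp_preimage hs (by fun_prop)]
  simp only [e.norm_map]

lemma measurePreserving_gauss_toLp_prod :
    MeasurePreserving (WithLp.toLp 2) ((gauss E).prod (gauss F)) (gauss (WithLp 2 (E × F))) := by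
  have h_meas : Measurable (WithLp.toLp 2 : E × F → WithLp 2 (E × F)) :=
    (WithLp.volume_preserving_toLp E F).measurable
  refine ⟨h_meas, Measure.ext fun s hs => ?_⟩
  rw [Measure.map_apply h_meas hs, gauss, gauss, gauss,
    prod_withDensity (by fun_prop) (by fun_prop), withDensity_apply _ (h_meas hs),
    withDensity_apply _ hs,
    ← (WithLp.volume_preserving_toLp E F).setLIntegral_comp_preimage hs (by fun_prop)]
  refine setLIntegral_congr_fun (h_meas hs) fun p _ => ?_
  rw [← ENNReal.ofReal_mul (exp_nonneg _), ← exp_add, ← mul_add, WithLp.prod_norm_sq_eq_of_L2,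
    WithLp.toLp_fst, WithLp.toLp_snd]

lemma charFun_gauss (t : E) : charFun (gauss E) t = Complex.exp (-‖t‖ ^ 2 / (4 * π)) := by
  have h_fourier := GaussianFourier.integral_cexp_neg_mul_sq_norm_add (V := E) (b := π)
    (by simpa using pi_pos) Complex.I t
  rw [div_self (Complex.ofReal_ne_zero.2 pi_ne_zero), Complex.one_cpow, one_mul] at h_fourier
  rw [charFun_apply, integral_gauss]
  convert h_fourier using 2
  · ext x
    rw [Complex.real_smul, Complex.ofReal_exp, ← Complex.exp_add, real_inner_comm]
    push_cast
    ring_nf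
  · simp

lemma gauss_eq_map_stdGaussian :
    gauss E = (stdGaussian E).map fun x => (√(2 * π))⁻¹ • x := by
  have : IsProbabilityMeasure ((stdGaussian E).map fun x => (√(2 * π))⁻¹ • x) :=
    Measure.isProbabilityMeasure_map (by fun_prop)
  refine Measure.ext_of_charFun (funext fun t => ?_)
  rw [charFun_gauss, charFun_map_smul, charFun_stdGaussian]
  congr 1
  rw [norm_smul, norm_inv, norm_of_nonneg (sqrt_nonneg _)]
  have h_sq : (√(2 * π) : ℂ) ^ 2 = 2 * π := by
    rw [← Complex.ofReal_pow, sq_sqrt (by positivity)]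
    simp
  push_cast
  rw [mul_pow, inv_pow, h_sq]
  field_simp
  ring

instance isGaussian_gauss : IsGaussian (gauss E) := by
  rw [gauss_eq_map_stdGaussian]
  exact isGaussian_map (((√(2 * π))⁻¹ : ℝ) • ContinuousLinearMap.id ℝ E)

lemma integral_id_gauss : ∫ x, x ∂gauss E = 0 := by
  rw [gauss_eq_map_stdGaussian, integral_map (by fun_prop) (by fun_prop), integral_smul,
    integral_id_stdGaussian, smul_zero]

lemma measurePreserving_gauss_rotation (φ : ℝ) :
    MeasurePreserving (ContinuousLinearMap.rotation φ : E × E →L[ℝ] E × E)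
      ((gauss E).prod (gauss E)) ((gauss E).prod (gauss E)) :=
  ⟨by fun_prop, IsGaussian.map_rotation_eq_self integral_id_gauss φ⟩

lemma integral_inner_mul_gauss {f f' : E → ℝ} {ξ : E} (hf : Integrable f (gauss E))
    (hf_inner : Integrable (fun x => ⟪ξ, x⟫_ℝ * f x) (gauss E)) (hf' : Integrable f' (gauss E))
    (h_deriv : ∀ x, HasLineDerivAt ℝ f (f' x) x ξ) :
    ∫ x, ⟪ξ, x⟫_ℝ * f x ∂gauss E = (2 * π)⁻¹ * ∫ x, f' x ∂gauss E := by
  have h_exp (x : E) : HasLineDerivAt ℝ (fun x : E => exp (-π * ‖x‖ ^ 2))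
      (-(2 * π) * (exp (-π * ‖x‖ ^ 2) * ⟪ξ, x⟫_ℝ)) x ξ := by
    have h := (((hasStrictFDerivAt_norm_sq x).hasFDerivAt.const_mul (-π)).exp).hasLineDerivAt ξ
    convert h using 1
    simp only [smul_apply, innerSL_apply_apply, smul_eq_mul, nsmul_eq_mul,
      real_inner_comm]
    push_cast
    ring
  rw [integrable_gauss_iff] at hf hf_inner hf'
  have h_parts := integral_bilinear_hasLineDerivAt_right_eq_neg_left_of_integrable
    (μ := (volume : Measure E)) (B := ContinuousLinearMap.mul ℝ ℝ) (f := f) (v := ξ)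
    (by simpa [mul_comm] using hf')
    (by simpa [mul_comm, mul_left_comm, mul_assoc] using hf_inner.const_mul (-(2 * π)))
    (by simpa [mul_comm] using hf) (fun x _ => h_deriv x) (fun x _ => h_exp x)
  simp only [ContinuousLinearMap.mul_apply', mul_left_comm (f _), mul_comm (f' _),
    mul_comm (f _), integral_const_mul] at h_parts
  rw [integral_gauss, integral_gauss, eq_inv_mul_iff_mul_eq₀ (by positivity)]
  simpa only [smul_eq_mul, neg_mul, neg_inj] using h_parts

end Gaussian

section Regular

open Real InnerProductSpace
open scoped Gradient

variable {E : Type*} [NormedAddCommGroup E] [InnerProductSpace ℝ E] [FiniteDimensional ℝ E]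

/-- The class of test functions on which the entropy production is computed: `C¹`, bounded away
from `0` and `∞`, with bounded gradient. -/
structure IsRegularDensity (u : E → ℝ) : Prop where
  contDiff : ContDiff ℝ 1 u
  exists_mem_Icc : ∃ m > 0, ∃ K, ∀ x, u x ∈ Set.Icc m K
  exists_norm_gradient_le : ∃ C, ∀ x, ‖∇ u x‖ ≤ C

namespace IsRegularDensity

variable {u : E → ℝ}

lemma hasGradientAt (hu : IsRegularDensity u) (x : E) : HasGradientAt u (∇ u x) x :=
  (hu.contDiff.differentiable one_ne_zero x).hasGradientAt

lemma continuous (hu : IsRegularDensity u) : Continuous u := hu.contDiff.continuous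

lemma pos (hu : IsRegularDensity u) (x : E) : 0 < u x := by
  obtain ⟨m, hm, K, h_mem⟩ := hu.exists_mem_Icc
  exact hm.trans_le (h_mem x).1

lemma continuous_gradient (hu : IsRegularDensity u) : Continuous (∇ u) :=
  (toDual ℝ E).symm.continuous.comp (hu.contDiff.continuous_fderiv one_ne_zero)

lemma of_hasGradientAt {g : E → E} (h_grad : ∀ x, HasGradientAt u (g x) x) (hg : Continuous g)
    (h_mem : ∃ m > 0, ∃ K, ∀ x, u x ∈ Set.Icc m K) (h_bdd : ∃ C, ∀ x, ‖g x‖ ≤ C) :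
    IsRegularDensity u where
  contDiff := by
    refine contDiff_one_iff_fderiv.2 ⟨fun x => (h_grad x).differentiableAt, ?_⟩
    have h_fderiv : fderiv ℝ u = fun x => toDual ℝ E (g x) :=
      funext fun x => (h_grad x).hasFDerivAt.fderiv
    rw [h_fderiv]
    exact (toDual ℝ E).continuous.comp hg
  exists_mem_Icc := h_mem
  exists_norm_gradient_le := by simpa only [fun x => (h_grad x).gradient] using h_bdd

variable {F : Type*} [NormedAddCommGroup F] [InnerProductSpace ℝ F] [FiniteDimensional ℝ F]

open ContinuousLinearMap (adjoint)

lemma norm_adjoint_gradient_le {C : ℝ} (hC : ∀ x, ‖∇ u x‖ ≤ C) {L : F →L[ℝ] E} (hL : ‖L‖ ≤ 1)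
    (x : E) : ‖adjoint L (∇ u x)‖ ≤ C := by
  simpa only [one_mul] using
    (adjoint L).le_of_opNorm_le_of_le ((adjoint.norm_map L).trans_le hL) (hC x)

variable [MeasurableSpace E] [BorelSpace E]
variable {Ω : Type*} [MeasurableSpace Ω] {P : Measure Ω} [IsProbabilityMeasure P]
  {A : Ω → F →L[ℝ] E} {b : Ω → E} {u : E → ℝ}

lemma integrable_comp (hu : IsRegularDensity u) {Y : Ω → E} (hY : Measurable Y) :
    Integrable (fun ω => u (Y ω)) P := by
  obtain ⟨m, -, K, h_mem⟩ := hu.exists_mem_Icc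
  exact .of_mem_Icc m K (hu.continuous.measurable.comp hY).aemeasurable
    (.of_forall fun ω => h_mem (Y ω))

variable [MeasurableSpace F] [BorelSpace F]

lemma measurable_adjoint_gradient (hu : IsRegularDensity u) (hA : Measurable A) {Y : Ω → E}
    (hY : Measurable Y) : Measurable fun ω => adjoint (A ω) (∇ u (Y ω)) := by
  have : Measurable fun ω => adjoint (A ω) := adjoint.continuous.measurable.comp hA
  have : Measurable fun ω => ∇ u (Y ω) := hu.continuous_gradient.measurable.comp hY
  fun_prop

lemma integrable_adjoint_gradient (hu : IsRegularDensity u) (hA : Measurable A)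
    (hA_norm : ∀ ω, ‖A ω‖ ≤ 1) {Y : Ω → E} (hY : Measurable Y) :
    Integrable (fun ω => adjoint (A ω) (∇ u (Y ω))) P := by
  obtain ⟨C, hC⟩ := hu.exists_norm_gradient_le
  exact .of_bound (hu.measurable_adjoint_gradient hA hY).aestronglyMeasurable C
    (.of_forall fun ω => norm_adjoint_gradient_le hC (hA_norm ω) _)

lemma hasGradientAt_integral_affine (hu : IsRegularDensity u) (hA : Measurable A)
    (hA_norm : ∀ ω, ‖A ω‖ ≤ 1) (hb : Measurable b) (x : F) :
    HasGradientAt (fun x => ∫ ω, u (A ω x + b ω) ∂P)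
      (∫ ω, adjoint (A ω) (∇ u (A ω x + b ω)) ∂P) x := by
  obtain ⟨C, hC⟩ := hu.exists_norm_gradient_le
  have h_meas (x : F) : Measurable fun ω => A ω x + b ω := by fun_prop
  have h_int := hu.integrable_adjoint_gradient (P := P) hA hA_norm (h_meas x)
  have h_fderiv := hasFDerivAt_integral_of_dominated_of_fderiv_le (μ := P) (𝕜 := ℝ)
    (F := fun x ω => u (A ω x + b ω))
    (F' := fun x ω => innerSL ℝ (adjoint (A ω) (∇ u (A ω x + b ω)))) (bound := fun _ => C)
    Filter.univ_mem
    (.of_forall fun y => (hu.integrable_comp (h_meas y)).aestronglyMeasurable)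
    (hu.integrable_comp (h_meas x))
    ((innerSL ℝ).continuous.comp_aestronglyMeasurable h_int.aestronglyMeasurable)
    (.of_forall fun ω y _ => by
      simpa using norm_adjoint_gradient_le hC (hA_norm ω) (A ω y + b ω))
    (integrable_const C)
    (.of_forall fun ω y _ => by
      refine ((hu.hasGradientAt (A ω y + b ω)).hasFDerivAt.comp y
        ((A ω).hasFDerivAt.add_const (b ω))).congr_fderiv ?_
      ext z
      simp [ContinuousLinearMap.adjoint_inner_left])
  exact h_fderiv.congr_fderiv ((innerSL ℝ).integral_comp_comm h_int)

lemma continuous_integral_affine_gradient (hu : IsRegularDensity u) (hA : Measurable A)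
    (hA_norm : ∀ ω, ‖A ω‖ ≤ 1) (hb : Measurable b) :
    Continuous fun x => ∫ ω, adjoint (A ω) (∇ u (A ω x + b ω)) ∂P := by
  obtain ⟨C, hC⟩ := hu.exists_norm_gradient_le
  refine continuous_of_dominated (bound := fun _ => C)
    (fun x => (hu.measurable_adjoint_gradient hA (by fun_prop)).aestronglyMeasurable)
    (fun x => .of_forall fun ω => norm_adjoint_gradient_le hC (hA_norm ω) _) (integrable_const C)
    (.of_forall fun ω => ?_)
  have h_grad := hu.continuous_gradient
  fun_prop

lemma integral_affine (hu : IsRegularDensity u) (hA : Measurable A)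
    (hA_norm : ∀ ω, ‖A ω‖ ≤ 1) (hb : Measurable b) :
    IsRegularDensity fun x => ∫ ω, u (A ω x + b ω) ∂P := by
  refine .of_hasGradientAt (hu.hasGradientAt_integral_affine hA hA_norm hb)
    (hu.continuous_integral_affine_gradient hA hA_norm hb) ?_ ?_
  · obtain ⟨m, hm, K, h_mem⟩ := hu.exists_mem_Icc
    exact ⟨m, hm, K, fun x => (convex_Icc m K).integral_mem isClosed_Icc
      (.of_forall fun ω => h_mem _) (hu.integrable_comp (by fun_prop))⟩
  · obtain ⟨C, hC⟩ := hu.exists_norm_gradient_le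
    refine ⟨C, fun x => ?_⟩
    simpa using norm_integral_le_of_norm_le_const (μ := P)
      (.of_forall fun ω => norm_adjoint_gradient_le hC (hA_norm ω) (A ω x + b ω))

end IsRegularDensity

end Regular

section Mehler

open Real InnerProductSpace Filter
open scoped Gradient

variable {E : Type*} [NormedAddCommGroup E] [InnerProductSpace ℝ E]

lemma norm_cos_smul_id_le (φ : ℝ) : ‖cos φ • ContinuousLinearMap.id ℝ E‖ ≤ 1 := by
  rw [norm_smul]
  exact mul_le_one₀ (abs_cos_le_one φ) (norm_nonneg _) ContinuousLinearMap.norm_id_le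

variable [FiniteDimensional ℝ E] {u : E → ℝ}

lemma abs_inner_gradient_le {C : ℝ} (hC : ∀ x, ‖∇ u x‖ ≤ C) (φ : ℝ) (x y z : E) :
    |⟪∇ u y, -sin φ • x + cos φ • z⟫_ℝ| ≤ C * (‖x‖ + ‖z‖) := by
  have h_sin : ‖-sin φ • x‖ ≤ ‖x‖ := by
    rw [norm_smul, norm_neg]
    exact mul_le_of_le_one_left (norm_nonneg x) (abs_sin_le_one φ)
  have h_cos : ‖cos φ • z‖ ≤ ‖z‖ := by
    rw [norm_smul]
    exact mul_le_of_le_one_left (norm_nonneg z) (abs_cos_le_one φ)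
  calc _ ≤ ‖∇ u y‖ * ‖-sin φ • x + cos φ • z‖ := abs_real_inner_le_norm _ _
    _ ≤ C * (‖x‖ + ‖z‖) :=
      mul_le_mul (hC y) (norm_add_le_of_le h_sin h_cos) (norm_nonneg _)
        ((norm_nonneg _).trans (hC y))

lemma abs_log_le_of_mem_Icc {m K y : ℝ} (hm : 0 < m) (hy : y ∈ Set.Icc m K) :
    |log y| ≤ max |log m| |log K| :=
  abs_le_max_abs_abs (log_le_log hm hy.1) (log_le_log (hm.trans_le hy.1) hy.2)

namespace IsRegularDensity

lemma continuous_log (hu : IsRegularDensity u) : Continuous fun x => log (u x) :=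
  hu.continuous.log fun x => (hu.pos x).ne'

lemma exists_abs_log_add_one_le (hu : IsRegularDensity u) :
    ∃ L, ∀ x, |log (u x) + 1| ≤ L := by
  obtain ⟨m, hm, K, h_mem⟩ := hu.exists_mem_Icc
  exact ⟨_, fun x => (abs_add_le _ _).trans
    (add_le_add (abs_log_le_of_mem_Icc hm (h_mem x)) abs_one.le)⟩

lemma exists_abs_inner_gradient_div_le (hu : IsRegularDensity u) :
    ∃ C ≥ 0, ∀ x ξ, |⟪∇ u x, ξ⟫_ℝ / u x| ≤ C * ‖ξ‖ := by
  obtain ⟨m, hm, K, h_mem⟩ := hu.exists_mem_Icc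
  obtain ⟨C, hC⟩ := hu.exists_norm_gradient_le
  have hC_nonneg : 0 ≤ C := (norm_nonneg _).trans (hC 0)
  refine ⟨C / m, by positivity, fun x ξ => ?_⟩
  rw [abs_div, abs_of_pos (hu.pos x), div_mul_eq_mul_div]
  exact div_le_div₀ (by positivity)
    ((abs_real_inner_le_norm _ _).trans (mul_le_mul_of_nonneg_right (hC x) (norm_nonneg ξ))) hm
    (h_mem x).1

end IsRegularDensity

variable [MeasurableSpace E] [BorelSpace E]

/-- The Ornstein–Uhlenbeck semigroup in Mehler's form, with the angle `φ` as time: `e^{-s} = cos φ`.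
It joins `u` at `φ = 0` to its mean at `φ = π / 2`. -/
def mehler (φ : ℝ) (u : E → ℝ) (x : E) : ℝ :=
  ∫ z, u (cos φ • x + sin φ • z) ∂gauss E

lemma mehler_zero (u : E → ℝ) : mehler 0 u = u := by
  ext x
  simp [mehler]

lemma mehler_pi_div_two (u : E → ℝ) (x : E) : mehler (π / 2) u x = ∫ z, u z ∂gauss E := by
  simp [mehler]

lemma mehler_mem_Icc (hu : IsRegularDensity u) {m K : ℝ} (h_mem : ∀ x, u x ∈ Set.Icc m K)
    (φ : ℝ) (x : E) : mehler φ u x ∈ Set.Icc m K :=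
  (convex_Icc m K).integral_mem isClosed_Icc (.of_forall fun _ => h_mem _)
    (hu.integrable_comp (by fun_prop))

lemma IsRegularDensity.mehler (hu : IsRegularDensity u) (φ : ℝ) :
    IsRegularDensity (mehler φ u) :=
  hu.integral_affine (A := fun _ : E => cos φ • ContinuousLinearMap.id ℝ E) measurable_const
    (fun _ => norm_cos_smul_id_le φ) (measurable_const_smul (sin φ))

lemma gradient_mehler (hu : IsRegularDensity u) (φ : ℝ) (x : E) :
    ∇ (mehler φ u) x = cos φ • ∫ z, ∇ u (cos φ • x + sin φ • z) ∂gauss E := by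
  have h_grad := hu.hasGradientAt_integral_affine (P := gauss E)
    (A := fun _ : E => cos φ • ContinuousLinearMap.id ℝ E) measurable_const
    (fun _ => norm_cos_smul_id_le φ) (measurable_const_smul (sin φ)) x
  have h_adj : ContinuousLinearMap.adjoint (ContinuousLinearMap.id ℝ E) = .id ℝ E :=
    ContinuousLinearMap.adjoint_id
  simpa [h_adj, integral_smul] using! h_grad.gradient

/-- The derivative in `φ` of `mehler φ u x`. -/
def mehlerDeriv (φ : ℝ) (u : E → ℝ) (x : E) : ℝ :=
  ∫ z, ⟪∇ u (cos φ • x + sin φ • z), -sin φ • x + cos φ • z⟫_ℝ ∂gauss E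

lemma integrable_norm_gauss : Integrable (fun z : E => ‖z‖) (gauss E) :=
  ProbabilityTheory.IsGaussian.integrable_id.norm

lemma hasDerivAt_mehler (hu : IsRegularDensity u) (φ : ℝ) (x : E) :
    HasDerivAt (fun φ => mehler φ u x) (mehlerDeriv φ u x) φ := by
  obtain ⟨C, hC⟩ := hu.exists_norm_gradient_le
  have h_grad := hu.continuous_gradient
  refine (hasDerivAt_integral_of_dominated_loc_of_deriv_le
    (F' := fun ψ z => ⟪∇ u (cos ψ • x + sin ψ • z), -sin ψ • x + cos ψ • z⟫_ℝ)
    (bound := fun z => C * (‖x‖ + ‖z‖))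
    univ_mem (.of_forall fun ψ => (hu.integrable_comp (by fun_prop)).aestronglyMeasurable)
    (hu.integrable_comp (by fun_prop)) (Continuous.aestronglyMeasurable (by fun_prop))
    (.of_forall fun z ψ _ => abs_inner_gradient_le hC ψ x _ z)
    (((integrable_const _).add integrable_norm_gauss).const_mul C)
    (.of_forall fun z ψ _ => ?_)).2
  have h_curve : HasDerivAt (fun ψ => cos ψ • x + sin ψ • z) (-sin ψ • x + cos ψ • z) ψ :=
    ((hasDerivAt_cos ψ).smul_const x).add ((hasDerivAt_sin ψ).smul_const z)
  exact (hu.hasGradientAt _).hasFDerivAt.comp_hasDerivAt ψ h_curve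

/-- The entropy `∫ u log u dγ`. -/
def gaussEntropy (u : E → ℝ) : ℝ := ∫ x, u x * log (u x) ∂gauss E

/-- The Fisher information `∫ ‖∇u‖² / u dγ`. -/
def fisher (u : E → ℝ) : ℝ := ∫ x, ‖∇ u x‖ ^ 2 / u x ∂gauss E

lemma abs_mehlerDeriv_le {C : ℝ} (hC : ∀ x, ‖∇ u x‖ ≤ C) (φ : ℝ) (x : E) :
    |mehlerDeriv φ u x| ≤ C * (‖x‖ + ∫ z, ‖z‖ ∂gauss E) := by
  have h_bound : Integrable (fun z => C * (‖x‖ + ‖z‖)) (gauss E) :=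
    ((integrable_const _).add integrable_norm_gauss).const_mul C
  calc |mehlerDeriv φ u x| ≤ ∫ z, C * (‖x‖ + ‖z‖) ∂gauss E := by
        rw [mehlerDeriv, ← norm_eq_abs]
        exact norm_integral_le_of_norm_le h_bound
          (.of_forall fun z => abs_inner_gradient_le hC φ x _ z)
    _ = C * (‖x‖ + ∫ z, ‖z‖ ∂gauss E) := by
        rw [integral_const_mul, integral_add (integrable_const _) integrable_norm_gauss]
        simp

lemma stronglyMeasurable_mehlerDeriv (hu : IsRegularDensity u) (φ : ℝ) :
    StronglyMeasurable (mehlerDeriv φ u) := by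
  have h_grad := hu.continuous_gradient
  exact StronglyMeasurable.integral_prod_right (f := fun x z =>
    ⟪∇ u (cos φ • x + sin φ • z), -sin φ • x + cos φ • z⟫_ℝ)
    (Continuous.stronglyMeasurable (by fun_prop))

lemma hasDerivAt_gaussEntropy_mehler (hu : IsRegularDensity u) (φ : ℝ) :
    HasDerivAt (fun φ => gaussEntropy (mehler φ u))
      (∫ x, (log (mehler φ u x) + 1) * mehlerDeriv φ u x ∂gauss E) φ := by
  obtain ⟨C, hC⟩ := hu.exists_norm_gradient_le
  obtain ⟨m, hm, K, h_mem⟩ := hu.exists_mem_Icc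
  have h_log (ψ : ℝ) (x : E) : |log (mehler ψ u x) + 1| ≤ max |log m| |log K| + 1 :=
    (abs_add_le _ _).trans (add_le_add
      (abs_log_le_of_mem_Icc hm (mehler_mem_Icc hu h_mem ψ x)) abs_one.le)
  have h_mul_log (ψ : ℝ) : Measurable fun x => mehler ψ u x * log (mehler ψ u x) :=
    continuous_mul_log.measurable.comp (hu.mehler ψ).continuous.measurable
  refine (hasDerivAt_integral_of_dominated_loc_of_deriv_le
    (F' := fun ψ x => (log (mehler ψ u x) + 1) * mehlerDeriv ψ u x)
    (bound := fun x => (max |log m| |log K| + 1) * (C * (‖x‖ + ∫ z, ‖z‖ ∂gauss E)))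
    univ_mem (.of_forall fun ψ => (h_mul_log ψ).aestronglyMeasurable)
    (.of_bound (h_mul_log φ).aestronglyMeasurable (K * max |log m| |log K|)
      (.of_forall fun x => ?_))
    (((hu.mehler φ).continuous.measurable.log.add_const 1).aestronglyMeasurable.mul
      (stronglyMeasurable_mehlerDeriv hu φ).aestronglyMeasurable)
    (.of_forall fun x ψ _ => ?_)
    (((integrable_norm_gauss.add (integrable_const _)).const_mul C).const_mul _)
    (.of_forall fun x ψ _ => ?_)).2
  · have h_val := mehler_mem_Icc hu h_mem φ x
    have h_pos := hm.trans_le h_val.1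
    rw [norm_mul, norm_of_nonneg h_pos.le]
    exact mul_le_mul h_val.2 (abs_log_le_of_mem_Icc hm h_val) (abs_nonneg _)
      (h_pos.le.trans h_val.2)
  · rw [norm_mul]
    exact mul_le_mul (h_log ψ x) (abs_mehlerDeriv_le hC ψ x) (abs_nonneg _) (by positivity)
  · exact (hasDerivAt_mul_log ((hu.mehler ψ).pos x).ne').comp ψ (hasDerivAt_mehler hu ψ x)

lemma integral_integral_rotation {f : E → E → ℝ} (φ : ℝ)
    (hf : Integrable (Function.uncurry f) ((gauss E).prod (gauss E))) :
    ∫ x, ∫ z, f x z ∂gauss E ∂gauss E = ∫ y, ∫ w,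
      f (cos φ • y - sin φ • w) (sin φ • y + cos φ • w) ∂gauss E ∂gauss E := by
  have h_rot := measurePreserving_gauss_rotation (E := E) (-φ)
  have h_apply (p : E × E) : ContinuousLinearMap.rotation (-φ) p =
      (cos φ • p.1 - sin φ • p.2, sin φ • p.1 + cos φ • p.2) := by
    simp [ContinuousLinearMap.rotation_apply, sub_eq_add_neg]
  have h_comp := h_rot.integrable_comp_of_integrable hf
  have h_int := integral_comp_of_measurePreserving h_rot hf.aestronglyMeasurable
  simp only [Function.comp_def, h_apply] at h_comp h_int
  exact (integral_integral hf).trans (h_int.symm.trans (integral_integral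
    (f := fun y w => f (cos φ • y - sin φ • w) (sin φ • y + cos φ • w)) h_comp).symm)

lemma integral_log_mul_inner_gauss (hu : IsRegularDensity u) (a b : ℝ) (y ξ : E) :
    ∫ w, (log (u (a • y - b • w)) + 1) * ⟪ξ, w⟫_ℝ ∂gauss E =
      -(b / (2 * π)) * ∫ w, ⟪∇ u (a • y - b • w), ξ⟫_ℝ / u (a • y - b • w) ∂gauss E := by
  obtain ⟨L, hL⟩ := hu.exists_abs_log_add_one_le
  obtain ⟨C, -, hC⟩ := hu.exists_abs_inner_gradient_div_le
  have h_u := hu.continuous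
  have h_grad := hu.continuous_gradient
  have h_log := hu.continuous_log.add_const 1
  have h_inner : Integrable (fun w : E => ⟪ξ, w⟫_ℝ) (gauss E) :=
    ProbabilityTheory.IsGaussian.integrable_id.const_inner ξ
  have h_log_meas : AEStronglyMeasurable (fun w => log (u (a • y - b • w)) + 1) (gauss E) :=
    (h_log.comp (g := fun x => log (u x) + 1) (by fun_prop)).aestronglyMeasurable
  have h_deriv_int : Integrable
      (fun w => ⟪∇ u (a • y - b • w), ξ⟫_ℝ / u (a • y - b • w)) (gauss E) :=
    .of_bound (Continuous.div (by fun_prop) (by fun_prop) fun w =>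
      (hu.pos _).ne').aestronglyMeasurable (C * ‖ξ‖) (.of_forall fun w => hC _ ξ)
  have h_deriv (w : E) : HasLineDerivAt ℝ (fun w => log (u (a • y - b • w)) + 1)
      (-b * (⟪∇ u (a • y - b • w), ξ⟫_ℝ / u (a • y - b • w))) w ξ := by
    have h_affine : HasFDerivAt (fun w => a • y - b • w) (-(b • .id ℝ E)) w :=
      ((hasFDerivAt_id w).const_smul b).const_sub _
    have h_comp : HasFDerivAt (fun w => u (a • y - b • w)) _ w :=
      (hu.hasGradientAt _).hasFDerivAt.comp w h_affine
    convert ((h_comp.log (hu.pos _).ne').add_const 1).hasLineDerivAt ξ using 1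
    rw [smul_apply, ContinuousLinearMap.comp_apply, neg_apply, smul_apply,
      ContinuousLinearMap.id_apply, toDual_apply_apply, inner_neg_right, inner_smul_right,
      smul_eq_mul]
    ring
  have h_parts := integral_inner_mul_gauss (.of_bound h_log_meas L (.of_forall fun w => hL _))
    (h_inner.mul_bdd h_log_meas (.of_forall fun w => hL _)) (h_deriv_int.const_mul (-b)) h_deriv
  simp only [mul_comm _ ⟪ξ, _⟫_ℝ]
  rw [h_parts, integral_const_mul]
  ring

/-- The dissipation identity: rotate the two Gaussian variables, integrate by parts, and rotate
back. -/
lemma integral_log_mul_mehlerDeriv {g : E → ℝ} (hu : IsRegularDensity u)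
    (hg : IsRegularDensity g) (φ : ℝ) :
    ∫ x, (log (g x) + 1) * mehlerDeriv φ u x ∂gauss E =
      -(sin φ / (2 * π)) *
        ∫ x, ∫ z, ⟪∇ g x, ∇ u (cos φ • x + sin φ • z)⟫_ℝ / g x ∂gauss E ∂gauss E := by
  obtain ⟨C, hC⟩ := hu.exists_norm_gradient_le
  obtain ⟨L, hL⟩ := hg.exists_abs_log_add_one_le
  obtain ⟨D, hD_nonneg, hD⟩ := hg.exists_abs_inner_gradient_div_le
  have h_grad := hu.continuous_gradient
  have h_gradg := hg.continuous_gradient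
  have h_g := hg.continuous
  have h_log := hg.continuous_log.add_const 1
  have h_unrotate (y w : E) :
      cos φ • (cos φ • y - sin φ • w) + sin φ • (sin φ • y + cos φ • w) = y := by
    match_scalars <;> linarith [sin_sq_add_cos_sq φ]
  have h_unrotate' (y w : E) :
      -sin φ • (cos φ • y - sin φ • w) + cos φ • (sin φ • y + cos φ • w) = w := by
    match_scalars <;> linarith [sin_sq_add_cos_sq φ]
  have h_int : Integrable (fun p : E × E => (log (g p.1) + 1) *
      ⟪∇ u (cos φ • p.1 + sin φ • p.2), -sin φ • p.1 + cos φ • p.2⟫_ℝ)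
      ((gauss E).prod (gauss E)) := by
    refine Integrable.bdd_mul (c := L) ?_
      (h_log.comp continuous_fst).aestronglyMeasurable (.of_forall fun p => hL p.1)
    exact .mono' (((integrable_norm_gauss.comp_fst _).add
      (integrable_norm_gauss.comp_snd _)).const_mul C)
      (Continuous.aestronglyMeasurable (by fun_prop))
      (.of_forall fun p => abs_inner_gradient_le hC φ _ _ _)
  have h_int' : Integrable (fun p : E × E => ⟪∇ g p.1, ∇ u (cos φ • p.1 + sin φ • p.2)⟫_ℝ / g p.1)
      ((gauss E).prod (gauss E)) :=
    .of_bound (Continuous.div (by fun_prop) (by fun_prop) fun p =>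
      (hg.pos _).ne').aestronglyMeasurable (D * C)
      (.of_forall fun p => (hD _ _).trans (by gcongr; exact hC _))
  simp only [mehlerDeriv, ← integral_const_mul (log (g _) + 1)]
  rw [integral_integral_rotation φ h_int, integral_integral_rotation (f := fun x z =>
    ⟪∇ g x, ∇ u (cos φ • x + sin φ • z)⟫_ℝ / g x) φ h_int']
  simp only [h_unrotate, h_unrotate', integral_log_mul_inner_gauss hg, integral_const_mul]

lemma hasDerivAt_gaussEntropy_mehler_fisher (hu : IsRegularDensity u) {φ : ℝ} (hφ : cos φ ≠ 0) :
    HasDerivAt (fun φ => gaussEntropy (mehler φ u))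
      (-(tan φ / (2 * π)) * fisher (mehler φ u)) φ := by
  have h_grad (x : E) : ∫ z, ∇ u (cos φ • x + sin φ • z) ∂gauss E =
      (cos φ)⁻¹ • ∇ (mehler φ u) x := by
    rw [gradient_mehler hu, inv_smul_smul₀ hφ]
  have h_int (x : E) : Integrable (fun z => ∇ u (cos φ • x + sin φ • z)) (gauss E) := by
    obtain ⟨C, hC⟩ := hu.exists_norm_gradient_le
    have h_cont := hu.continuous_gradient
    exact .of_bound (Continuous.aestronglyMeasurable (by fun_prop)) C (.of_forall fun z => hC _)
  convert hasDerivAt_gaussEntropy_mehler hu φ using 1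
  rw [integral_log_mul_mehlerDeriv hu (hu.mehler φ)]
  simp only [integral_div, integral_inner (h_int _), h_grad, inner_smul_right,
    real_inner_self_eq_norm_sq, mul_div_assoc, integral_const_mul, fisher, tan_eq_sin_div_cos]
  ring

end Mehler

section Thermostat

open Real InnerProductSpace
open scoped Gradient
open ContinuousLinearMap (adjoint)

lemma sq_norm_integral_div_le {Ω E : Type*} [MeasurableSpace Ω] [NormedAddCommGroup E]
    [InnerProductSpace ℝ E] [CompleteSpace E] {P : Measure Ω} {X : Ω → E} {Y : Ω → ℝ}
    (hX : Integrable X P) (hY : Integrable Y P) (hY_pos : ∀ ω, 0 < Y ω)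
    (hXY : Integrable (fun ω => ‖X ω‖ ^ 2 / Y ω) P) :
    ‖∫ ω, X ω ∂P‖ ^ 2 / ∫ ω, Y ω ∂P ≤ ∫ ω, ‖X ω‖ ^ 2 / Y ω ∂P := by
  rcases eq_or_ne (∫ ω, Y ω ∂P) 0 with h_zero | h_ne
  · rw [h_zero, div_zero]
    exact integral_nonneg fun ω => div_nonneg (sq_nonneg _) (hY_pos ω).le
  set a := (∫ ω, Y ω ∂P)⁻¹ • ∫ ω, X ω ∂P with ha
  have h_young (ω : Ω) : 2 * ⟪a, X ω⟫_ℝ - ‖a‖ ^ 2 * Y ω ≤ ‖X ω‖ ^ 2 / Y ω := by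
    rw [le_div_iff₀ (hY_pos ω)]
    have h_cs := abs_le.1 (abs_real_inner_le_norm a (X ω))
    nlinarith [sq_nonneg (‖a‖ * Y ω - ‖X ω‖), hY_pos ω]
  calc _ = 2 * ⟪a, ∫ ω, X ω ∂P⟫_ℝ - ‖a‖ ^ 2 * ∫ ω, Y ω ∂P := by
        rw [ha, real_inner_smul_left, real_inner_self_eq_norm_sq, norm_smul, mul_pow, norm_inv,
          inv_pow, norm_eq_abs, sq_abs]
        field_simp
        ring
    _ = ∫ ω, 2 * ⟪a, X ω⟫_ℝ - ‖a‖ ^ 2 * Y ω ∂P := by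
        rw [integral_sub ((hX.const_inner a).const_mul 2) (hY.const_mul _), integral_const_mul,
          integral_const_mul, integral_inner hX]
    _ ≤ _ := integral_mono (((hX.const_inner a).const_mul 2).sub (hY.const_mul _)) hXY h_young

lemma measurePreserving_gauss_cos_smul_add_sin_smul {E : Type*} [NormedAddCommGroup E]
    [InnerProductSpace ℝ E] [FiniteDimensional ℝ E] [MeasurableSpace E] [BorelSpace E] (φ : ℝ) :
    MeasurePreserving (fun p : E × E => cos φ • p.1 + sin φ • p.2) ((gauss E).prod (gauss E))
      (gauss E) :=
  measurePreserving_fst.comp (measurePreserving_gauss_rotation φ)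

lemma measurePreserving_prod_leftComm {α β γ : Type*} [MeasurableSpace α] [MeasurableSpace β]
    [MeasurableSpace γ] (μ : Measure α) (ν : Measure β) (τ : Measure γ) [SFinite μ] [SFinite ν]
    [SFinite τ] :
    MeasurePreserving (fun x : α × β × γ => (x.2.1, x.1, x.2.2)) (μ.prod (ν.prod τ))
      (ν.prod (μ.prod τ)) :=
  (measurePreserving_prodAssoc ν μ τ).comp
    ((Measure.measurePreserving_swap.prod (MeasurePreserving.id τ)).comp
      (measurePreserving_prodAssoc μ ν τ).symm)

variable {V W Ω : Type*}
  [NormedAddCommGroup V] [InnerProductSpace ℝ V] [FiniteDimensional ℝ V] [MeasurableSpace V]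
  [BorelSpace V]
  [NormedAddCommGroup W] [InnerProductSpace ℝ W] [FiniteDimensional ℝ W] [MeasurableSpace W]
  [BorelSpace W] [MeasurableSpace Ω]

/-- A random linear map `v ↦ A v + B w` of a system `v` driven by Gaussian noise `w` from a
reservoir, which leaves the Gaussian law of the system invariant. -/
structure IsThermostat (A : Ω → V →L[ℝ] V) (B : Ω → W →L[ℝ] V) : Prop where
  measurable_system : Measurable A
  measurable_reservoir : Measurable B
  norm_le_one : ∀ ω, ‖A ω‖ ≤ 1
  measurePreserving : ∀ ω, MeasurePreserving (fun p : V × W => A ω p.1 + B ω p.2)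
    ((gauss V).prod (gauss W)) (gauss V)

/-- The average of `u` over one step of the random map `v ↦ A v + B w`. -/
def thermostat (P : Measure Ω) (A : Ω → V →L[ℝ] V) (B : Ω → W →L[ℝ] V) (u : V → ℝ) (v : V) : ℝ :=
  ∫ p, u (A p.1 v + B p.1 p.2) ∂P.prod (gauss W)

variable {P : Measure Ω} [IsProbabilityMeasure P] {A : Ω → V →L[ℝ] V} {B : Ω → W →L[ℝ] V}
  {u : V → ℝ} {q : ℝ}

namespace IsThermostat

lemma measurable_affine (h : IsThermostat A B) {X : Type*} [MeasurableSpace X] {ω : X → Ω}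
    {v : X → V} {w : X → W} (hω : Measurable ω) (hv : Measurable v) (hw : Measurable w) :
    Measurable fun x => A (ω x) (v x) + B (ω x) (w x) := by
  have hA : Measurable fun x => A (ω x) (v x) :=
    isBoundedBilinearMap_apply.continuous.measurable.comp
      ((h.measurable_system.comp hω).prodMk hv)
  have hB : Measurable fun x => B (ω x) (w x) :=
    isBoundedBilinearMap_apply.continuous.measurable.comp
      ((h.measurable_reservoir.comp hω).prodMk hw)
  exact hA.add hB

lemma measurable_reservoir_apply (h : IsThermostat A B) :
    Measurable fun p : Ω × W => B p.1 p.2 := by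
  simpa only [map_zero, zero_add] using
    h.measurable_affine measurable_fst (measurable_const (a := 0)) measurable_snd

lemma measurePreserving_pair (h : IsThermostat A B) :
    MeasurePreserving (fun x : V × Ω × W => (x.2.1, A x.2.1 x.1 + B x.2.1 x.2.2))
      ((gauss V).prod (P.prod (gauss W))) (P.prod (gauss V)) :=
  ((MeasurePreserving.id P).skew_product (g := fun ω (p : V × W) => A ω p.1 + B ω p.2)
    (h.measurable_affine measurable_fst (by fun_prop) (by fun_prop))
    (.of_forall fun ω => (h.measurePreserving ω).map_eq)).comp
    (measurePreserving_prod_leftComm (gauss V) P (gauss W))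

lemma measurePreserving_affine (h : IsThermostat A B) :
    MeasurePreserving (fun x : V × Ω × W => A x.2.1 x.1 + B x.2.1 x.2.2)
      ((gauss V).prod (P.prod (gauss W))) (gauss V) :=
  measurePreserving_snd.comp h.measurePreserving_pair

lemma integral_thermostat (h : IsThermostat A B) (hu : Integrable u (gauss V)) :
    ∫ v, thermostat P A B u v ∂gauss V = ∫ v, u v ∂gauss V := by
  simp only [thermostat]
  rw [integral_integral (f := fun v (p : Ω × W) => u (A p.1 v + B p.1 p.2))
    (h.measurePreserving_affine.integrable_comp_of_integrable hu)]
  exact integral_comp_of_measurePreserving h.measurePreserving_affine hu.aestronglyMeasurable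

lemma thermostat_nonneg (h : IsThermostat A B) (hu : 0 ≤ᵐ[gauss V] u) :
    0 ≤ᵐ[gauss V] thermostat P A B u :=
  (Measure.ae_ae_of_ae_prod (h.measurePreserving_affine.quasiMeasurePreserving.ae hu)).mono
    fun _ hv => integral_nonneg_of_ae hv

lemma isRegularDensity (h : IsThermostat A B) (hu : IsRegularDensity u) :
    IsRegularDensity (thermostat P A B u) := by
  exact hu.integral_affine (A := fun p : Ω × W => A p.1) (b := fun p => B p.1 p.2)
    (h.measurable_system.comp measurable_fst) (fun p => h.norm_le_one p.1)
    h.measurable_reservoir_apply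

lemma gradient_thermostat (h : IsThermostat A B) (hu : IsRegularDensity u) (v : V) :
    ∇ (thermostat P A B u) v =
      ∫ p, adjoint (A p.1) (∇ u (A p.1 v + B p.1 p.2)) ∂P.prod (gauss W) := by
  exact (hu.hasGradientAt_integral_affine (A := fun p : Ω × W => A p.1) (b := fun p => B p.1 p.2)
    (h.measurable_system.comp measurable_fst) (fun p => h.norm_le_one p.1)
    h.measurable_reservoir_apply v).gradient

/-- Resolve the reservoir variable as `cos φ • w + sin φ • w'`: the part `w'` recombines with `z`
into a Gaussian vector of the system. -/
lemma integral_sin_smul_system (h : IsThermostat A B) (hu : IsRegularDensity u) (φ : ℝ) (x : V)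
    (ω : Ω) :
    ∫ p, u (x + sin φ • A ω p.1 + B ω p.2) ∂(gauss V).prod (gauss W) =
      ∫ p, u (x + cos φ • B ω p.1 + sin φ • p.2) ∂(gauss W).prod (gauss V) := by
  have h_u := hu.continuous
  have h_resolve := (MeasurePreserving.id (gauss V)).prod
    (measurePreserving_gauss_cos_smul_add_sin_smul (E := W) φ)
  have h_recombine := ((MeasurePreserving.id (gauss W)).prod (h.measurePreserving ω)).comp
    (measurePreserving_prod_leftComm (gauss V) (gauss W) (gauss W))
  rw [← integral_comp_of_measurePreserving h_resolve
      (Continuous.aestronglyMeasurable (by fun_prop)),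
    ← integral_comp_of_measurePreserving h_recombine
      (Continuous.aestronglyMeasurable (by fun_prop))]
  refine integral_congr_ae (.of_forall fun p => congrArg u ?_)
  change x + sin φ • A ω p.1 + B ω (cos φ • p.2.1 + sin φ • p.2.2) =
    x + cos φ • B ω p.2.1 + sin φ • (A ω p.1 + B ω p.2.2)
  rw [map_add, map_smul, map_smul]
  module

lemma thermostat_mehler (h : IsThermostat A B) (hu : IsRegularDensity u) (φ : ℝ) :
    thermostat P A B (mehler φ u) = mehler φ (thermostat P A B u) := by
  ext v
  have h_left : thermostat P A B (mehler φ u) v = ∫ ω, ∫ p,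
      u (cos φ • A ω v + cos φ • B ω p.1 + sin φ • p.2) ∂(gauss W).prod (gauss V) ∂P := by
    rw [thermostat, integral_prod _ ((hu.mehler φ).integrable_comp
      (h.measurable_affine measurable_fst measurable_const measurable_snd))]
    simp only [mehler, smul_add]
    refine integral_congr_ae (.of_forall fun ω => ?_)
    exact integral_integral
      (f := fun w z => u (cos φ • A ω v + cos φ • B ω w + sin φ • z))
      (hu.integrable_comp (by fun_prop))
  have h_right : mehler φ (thermostat P A B u) v = ∫ ω, ∫ p,
      u (cos φ • A ω v + sin φ • A ω p.1 + B ω p.2) ∂(gauss V).prod (gauss W) ∂P := by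
    have h_int : Integrable (fun x : Ω × V × W =>
        u (A x.1 (cos φ • v + sin φ • x.2.1) + B x.1 x.2.2)) (P.prod ((gauss V).prod (gauss W))) :=
      hu.integrable_comp (h.measurable_affine measurable_fst (by fun_prop) (by fun_prop))
    have h_comm := measurePreserving_prod_leftComm (gauss V) P (gauss W)
    have h_swap := integral_comp_of_measurePreserving h_comm h_int.aestronglyMeasurable
    have h_iter := integral_prod _ (h_comm.integrable_comp_of_integrable h_int)
    simp only [Function.comp_def] at h_iter
    rw [h_iter, integral_prod _ h_int] at h_swap
    simpa only [mehler, thermostat, map_add, map_smul] using h_swap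
  rw [h_left, h_right]
  exact integral_congr_ae (.of_forall fun ω => (h.integral_sin_smul_system hu φ _ ω).symm)

lemma integrable_sq_norm_adjoint_gradient_div (h : IsThermostat A B) (hu : IsRegularDensity u)
    {X : Type*} [MeasurableSpace X] {Q : Measure X} [IsProbabilityMeasure Q] {ω : X → Ω}
    {y : X → V} (hω : Measurable ω) (hy : Measurable y) :
    Integrable (fun x => ‖adjoint (A (ω x)) (∇ u (y x))‖ ^ 2 / u (y x)) Q := by
  obtain ⟨m, hm, K, h_mem⟩ := hu.exists_mem_Icc
  obtain ⟨C, hC⟩ := hu.exists_norm_gradient_le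
  have hA := h.measurable_system.comp hω
  refine .of_bound (((hu.measurable_adjoint_gradient hA hy).norm.pow_const 2).div
    (hu.continuous.measurable.comp hy)).aestronglyMeasurable (C ^ 2 / m) (.of_forall fun x => ?_)
  rw [norm_of_nonneg (div_nonneg (sq_nonneg _) (hu.pos _).le)]
  have h_norm := IsRegularDensity.norm_adjoint_gradient_le hC (h.norm_le_one (ω x)) (y x)
  exact div_le_div₀ (sq_nonneg C) (pow_le_pow_left₀ (norm_nonneg _) h_norm 2) hm (h_mem _).1

lemma sq_norm_gradient_thermostat_div_le (h : IsThermostat A B) (hu : IsRegularDensity u)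
    (v : V) :
    ‖∇ (thermostat P A B u) v‖ ^ 2 / thermostat P A B u v ≤
      ∫ p, ‖adjoint (A p.1) (∇ u (A p.1 v + B p.1 p.2))‖ ^ 2 / u (A p.1 v + B p.1 p.2)
        ∂P.prod (gauss W) := by
  have h_meas : Measurable fun p : Ω × W => A p.1 v + B p.1 p.2 :=
    h.measurable_affine measurable_fst measurable_const measurable_snd
  rw [h.gradient_thermostat hu]
  exact sq_norm_integral_div_le
    (hu.integrable_adjoint_gradient (h.measurable_system.comp measurable_fst)
      (fun p => h.norm_le_one p.1) h_meas)
    (hu.integrable_comp h_meas) (fun _ => hu.pos _)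
    (h.integrable_sq_norm_adjoint_gradient_div hu measurable_fst h_meas)

lemma fisher_thermostat_le (h : IsThermostat A B) (hu : IsRegularDensity u)
    (hq : ∀ ξ, ∫ ω, ‖adjoint (A ω) ξ‖ ^ 2 ∂P = q * ‖ξ‖ ^ 2) :
    fisher (thermostat P A B u) ≤ q * fisher u := by
  have h_int : Integrable (fun x : Ω × V => ‖adjoint (A x.1) (∇ u x.2)‖ ^ 2 / u x.2)
      (P.prod (gauss V)) :=
    h.integrable_sq_norm_adjoint_gradient_div hu measurable_fst measurable_snd
  have h_pair := h.measurePreserving_pair (P := P)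
  have h_int_pair := h_pair.integrable_comp_of_integrable h_int
  calc fisher (thermostat P A B u)
      ≤ ∫ v, ∫ p, ‖adjoint (A p.1) (∇ u (A p.1 v + B p.1 p.2))‖ ^ 2 / u (A p.1 v + B p.1 p.2)
          ∂P.prod (gauss W) ∂gauss V :=
        integral_mono_of_nonneg
          (.of_forall fun v => div_nonneg (sq_nonneg _) ((h.isRegularDensity hu).pos v).le)
          h_int_pair.integral_prod_left
          (.of_forall (h.sq_norm_gradient_thermostat_div_le hu))
    _ = ∫ x, ‖adjoint (A x.1) (∇ u x.2)‖ ^ 2 / u x.2 ∂P.prod (gauss V) :=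
        (integral_prod _ h_int_pair).symm.trans
          (integral_comp_of_measurePreserving h_pair h_int.aestronglyMeasurable)
    _ = q * fisher u := by
        rw [integral_prod_symm _ h_int, fisher, ← integral_const_mul]
        simp only [integral_div, hq, mul_div_assoc]

/-- Along the Ornstein–Uhlenbeck flow, which commutes with the thermostat, the entropy deficit is
dissipated at a rate given by the Fisher information. -/
lemma gaussEntropy_thermostat_le (h : IsThermostat A B) (hu : IsRegularDensity u)
    (hq : ∀ ξ, ∫ ω, ‖adjoint (A ω) ξ‖ ^ 2 ∂P = q * ‖ξ‖ ^ 2) :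
    gaussEntropy (thermostat P A B u) ≤
      q * gaussEntropy u + (1 - q) * ((∫ v, u v ∂gauss V) * log (∫ v, u v ∂gauss V)) := by
  have hT := h.isRegularDensity (P := P) hu
  let D := fun φ => gaussEntropy (mehler φ (thermostat P A B u)) - q * gaussEntropy (mehler φ u)
  have h_cont : Continuous D := continuous_iff_continuousAt.2 fun φ =>
    ((hasDerivAt_gaussEntropy_mehler hT φ).continuousAt).sub
      ((hasDerivAt_gaussEntropy_mehler hu φ).continuousAt.const_mul q)
  have h_mono : MonotoneOn D (Set.Icc 0 (π / 2)) := by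
    refine monotoneOn_of_hasDerivWithinAt_nonneg (f' := fun φ => tan φ / (2 * π) *
        (q * fisher (mehler φ u) - fisher (thermostat P A B (mehler φ u))))
      (convex_Icc _ _) h_cont.continuousOn (fun φ hφ => ?_) fun φ hφ => ?_
    all_goals rw [interior_Icc] at hφ
    · have h_cos : cos φ ≠ 0 := (cos_pos_of_mem_Ioo ⟨by linarith [hφ.1, pi_pos], hφ.2⟩).ne'
      have h_deriv : HasDerivAt D _ φ := (hasDerivAt_gaussEntropy_mehler_fisher hT h_cos).sub
        ((hasDerivAt_gaussEntropy_mehler_fisher hu h_cos).const_mul q)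
      refine (h_deriv.congr_deriv ?_).hasDerivWithinAt
      rw [h.thermostat_mehler hu]
      ring
    · have h_tan := tan_nonneg_of_nonneg_of_le_pi_div_two hφ.1.le hφ.2.le
      exact mul_nonneg (by positivity) (sub_nonneg.2 (h.fisher_thermostat_le (hu.mehler φ) hq))
  have h_le := h_mono (Set.left_mem_Icc.2 pi_div_two_pos.le) (Set.right_mem_Icc.2 pi_div_two_pos.le)
    pi_div_two_pos.le
  simp only [D, mehler_zero, gaussEntropy, mehler_pi_div_two, integral_const, probReal_univ,
    one_smul] at h_le
  rw [h.integral_thermostat (u := u) (hu.integrable_comp measurable_id)] at h_le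
  simp only [gaussEntropy]
  linarith

end IsThermostat

end Thermostat

section RelativeEntropy

open Filter Topology InformationTheory
open scoped ENNReal

lemma klFun_le_max_of_mem_Icc {a b x : ℝ} (ha : 0 ≤ a) (hx : x ∈ Set.Icc a b) :
    klFun x ≤ max (klFun a) (klFun b) :=
  convexOn_klFun.le_max_of_mem_Icc (Set.mem_Ici.2 ha)
    (Set.mem_Ici.2 (ha.trans (hx.1.trans hx.2))) hx

lemma klFun_clamp_le {a b x : ℝ} (ha : a ≤ 1) (hb : 1 ≤ b) (hx : 0 ≤ x) :
    klFun (max a (min x b)) ≤ klFun x := by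
  have h_nonneg := klFun_nonneg hx
  rcases le_total x 1 with h | h
  · have h_max := klFun_le_max_of_mem_Icc (x := max a (min x b)) hx
      ⟨le_max_of_le_right (le_min le_rfl (h.trans hb)), max_le ha (min_le_of_left_le h)⟩
    rwa [klFun_one, max_eq_left h_nonneg] at h_max
  · have h_max := klFun_le_max_of_mem_Icc (x := max a (min x b)) zero_le_one
      ⟨le_max_of_le_right (le_min h hb), max_le (ha.trans h) (min_le_left x b)⟩
    rwa [klFun_one, max_eq_right h_nonneg] at h_max

lemma norm_clamp_sub_le {a b x : ℝ} (ha : 0 ≤ a) (ha' : a ≤ 1) (hx : 0 ≤ x) :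
    ‖max a (min x b) - x‖ ≤ x + 1 := by
  rw [Real.norm_eq_abs, abs_le]
  have h_le : max a (min x b) ≤ x + 1 := max_le (by linarith) (by linarith [min_le_left x b])
  have h_nonneg : 0 ≤ max a (min x b) := ha.trans (le_max_left _ _)
  constructor <;> linarith

variable {α : Type*} [MeasurableSpace α] {μ : Measure α}

/-- The entropy `∫ (h log h + 1 - h) dμ` of a density `h` relative to `μ`. The integrand is
nonnegative for `h ≥ 0`, so that the value `∞` is allowed. -/
def klEntropy (μ : Measure α) (h : α → ℝ) : ℝ≥0∞ := ∫⁻ x, ENNReal.ofReal (klFun (h x)) ∂μ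

lemma klEntropy_congr {h h' : α → ℝ} (hh : h =ᵐ[μ] h') : klEntropy μ h = klEntropy μ h' :=
  lintegral_congr_ae (hh.fun_comp fun y => ENNReal.ofReal (klFun y))

lemma klEntropy_clamp_le {a b : ℝ} {h : α → ℝ} (ha : a ≤ 1) (hb : 1 ≤ b)
    (h_nonneg : 0 ≤ᵐ[μ] h) : klEntropy μ (fun x => max a (min (h x) b)) ≤ klEntropy μ h :=
  lintegral_mono_ae (h_nonneg.mono fun _ hx => ENNReal.ofReal_le_ofReal (klFun_clamp_le ha hb hx))

lemma klEntropy_le_of_tendsto {f : ℕ → α → ℝ} {h : α → ℝ} {c : ℕ → ℝ≥0∞} {d : ℝ≥0∞}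
    (hf : ∀ n, AEStronglyMeasurable (f n) μ) (hh : AEStronglyMeasurable h μ)
    (h_lim : Tendsto (fun n => ∫⁻ x, ‖f n x - h x‖ₑ ∂μ) atTop (𝓝 0))
    (h_le : ∀ n, klEntropy μ (f n) ≤ c n) (hc : Tendsto c atTop (𝓝 d)) : klEntropy μ h ≤ d := by
  have h_eLpNorm : Tendsto (fun n => eLpNorm (f n - h) 1 μ) atTop (𝓝 0) := by
    simpa only [eLpNorm_one_eq_lintegral_enorm, Pi.sub_apply] using h_lim
  obtain ⟨k, hk, h_ae⟩ := (tendstoInMeasure_of_tendsto_eLpNorm one_ne_zero hf hh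
    h_eLpNorm).exists_seq_tendsto_ae
  have h_cont := ENNReal.continuous_ofReal.comp continuous_klFun
  calc klEntropy μ h
      = ∫⁻ x, liminf (fun n => ENNReal.ofReal (klFun (f (k n) x))) atTop ∂μ :=
        lintegral_congr_ae (h_ae.mono fun x hx => ((h_cont.tendsto _).comp hx).liminf_eq.symm)
    _ ≤ liminf (fun n => klEntropy μ (f (k n))) atTop :=
        lintegral_liminf_le' fun n => (h_cont.comp_aestronglyMeasurable (hf (k n))).aemeasurable
    _ ≤ liminf (fun n => c (k n)) atTop := liminf_le_liminf (.of_forall fun n => h_le (k n))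
    _ = d := (hc.comp hk.tendsto_atTop).liminf_eq

lemma tendsto_klEntropy_of_mem_Icc [IsFiniteMeasure μ] {f : ℕ → α → ℝ} {h : α → ℝ} {m K : ℝ}
    (hm : 0 ≤ m) (hf : ∀ n, AEStronglyMeasurable (f n) μ) (h_mem : ∀ n x, f n x ∈ Set.Icc m K)
    (h_lim : ∀ᵐ x ∂μ, Tendsto (fun n => f n x) atTop (𝓝 (h x))) :
    Tendsto (fun n => klEntropy μ (f n)) atTop (𝓝 (klEntropy μ h)) := by
  have h_cont := ENNReal.continuous_ofReal.comp continuous_klFun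
  refine tendsto_lintegral_of_dominated_convergence'
    (fun _ => ENNReal.ofReal (max (klFun m) (klFun K)))
    (fun n => (h_cont.comp_aestronglyMeasurable (hf n)).aemeasurable)
    (fun n => .of_forall fun x => ENNReal.ofReal_le_ofReal
      (klFun_le_max_of_mem_Icc hm (h_mem n x))) ?_
    (h_lim.mono fun x hx => (h_cont.tendsto _).comp hx)
  rw [lintegral_const]
  exact ENNReal.mul_ne_top ENNReal.ofReal_ne_top (measure_ne_top μ _)

lemma tendsto_lintegral_enorm_sub {f : ℕ → α → ℝ} {h b : α → ℝ}
    (hf : ∀ n, AEStronglyMeasurable (f n) μ) (hh : AEStronglyMeasurable h μ) (hb : Integrable b μ)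
    (h_le : ∀ n, ∀ᵐ x ∂μ, ‖f n x - h x‖ ≤ b x)
    (h_lim : ∀ᵐ x ∂μ, Tendsto (fun n => f n x) atTop (𝓝 (h x))) :
    Tendsto (fun n => ∫⁻ x, ‖f n x - h x‖ₑ ∂μ) atTop (𝓝 0) := by
  have h_dom := tendsto_lintegral_norm_of_dominated_convergence (f := fun _ => (0 : ℝ))
    (F := fun n x => f n x - h x) (fun n => (hf n).sub hh) hb.hasFiniteIntegral h_le
    (h_lim.mono fun x hx => by simpa only [sub_self] using hx.sub_const (h x))
  simpa only [sub_zero, ofReal_norm] using h_dom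

end RelativeEntropy

section Mollification

open Filter Topology InnerProductSpace
open scoped Convolution Gradient

variable {E : Type*} [NormedAddCommGroup E] [InnerProductSpace ℝ E] [FiniteDimensional ℝ E]
  [MeasurableSpace E] [BorelSpace E] {g : E → ℝ} {m K : ℝ}

lemma convolution_normed_mem_Icc (φ : ContDiffBump (0 : E)) (hg : LocallyIntegrable g)
    (h_mem : ∀ x, g x ∈ Set.Icc m K) (x : E) :
    (φ.normed volume ⋆[ContinuousLinearMap.lsmul ℝ ℝ, volume] g) x ∈ Set.Icc m K := by
  have h_int : Integrable (fun t => φ.normed volume t * g (x - t)) :=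
    φ.hasCompactSupport_normed.convolutionExists_left (ContinuousLinearMap.lsmul ℝ ℝ)
      φ.continuous_normed hg x
  have hφ : Integrable (φ.normed volume) := φ.integrable_normed
  have h_const (c : ℝ) : ∫ t, φ.normed volume t * c = c := by
    rw [integral_mul_const, φ.integral_normed, one_mul]
  constructor
  · rw [← h_const m]
    exact integral_mono (hφ.mul_const m) h_int fun t =>
      mul_le_mul_of_nonneg_left (h_mem _).1 (φ.nonneg_normed t)
  · rw [← h_const K]
    exact integral_mono h_int (hφ.mul_const K) fun t =>
      mul_le_mul_of_nonneg_left (h_mem _).2 (φ.nonneg_normed t)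

lemma exists_norm_gradient_convolution_le {φ : E → ℝ} (hφ : ContDiff ℝ 1 φ)
    (hφ_supp : HasCompactSupport φ) (hg : LocallyIntegrable g) (hK : ∀ x, ‖g x‖ ≤ K) :
    ∃ C, ∀ x, ‖∇ (φ ⋆[ContinuousLinearMap.lsmul ℝ ℝ, volume] g) x‖ ≤ C := by
  have hK_nonneg : 0 ≤ K := (norm_nonneg _).trans (hK 0)
  have h_int : Integrable fun t => ‖fderiv ℝ φ t‖ * K :=
    ((hφ.continuous_fderiv one_ne_zero).integrable_of_hasCompactSupport
      (hφ_supp.fderiv ℝ)).norm.mul_const K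
  refine ⟨∫ t, ‖fderiv ℝ φ t‖ * K, fun x => ?_⟩
  rw [gradient, (toDual ℝ E).symm.norm_map,
    (hφ_supp.hasFDerivAt_convolution_left _ hφ hg x).fderiv]
  refine norm_integral_le_of_norm_le h_int (.of_forall fun t =>
    ContinuousLinearMap.opNorm_le_bound _ (by positivity) fun y => ?_)
  rw [ContinuousLinearMap.precompL_apply, ContinuousLinearMap.lsmul_apply, norm_smul,
    mul_right_comm]
  exact mul_le_mul (ContinuousLinearMap.le_opNorm _ y) (hK _) (norm_nonneg _) (by positivity)

lemma exists_isRegularDensity_tendsto (hg : AEStronglyMeasurable g volume) (hm : 0 < m)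
    (h_mem : ∀ x, g x ∈ Set.Icc m K) :
    ∃ u : ℕ → E → ℝ, (∀ n, IsRegularDensity (u n)) ∧ (∀ n x, u n x ∈ Set.Icc m K) ∧
      ∀ᵐ x, Tendsto (fun n => u n x) atTop (𝓝 (g x)) := by
  have hK (x : E) : ‖g x‖ ≤ K :=
    (Real.norm_of_nonneg (hm.le.trans (h_mem x).1)).trans_le (h_mem x).2
  have hg_loc : LocallyIntegrable g := (locallyIntegrable_const K).mono hg
    (.of_forall fun x => (hK x).trans (le_abs_self K))
  let φ (n : ℕ) : ContDiffBump (0 : E) :=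
    { rIn := 1 / ((n : ℝ) + 1), rOut := 2 / ((n : ℝ) + 1), rIn_pos := by positivity,
      rIn_lt_rOut := by gcongr; norm_num }
  have h_rOut : Tendsto (fun n => (φ n).rOut) atTop (𝓝 0) := by
    simpa only [φ, mul_one_div, mul_zero] using
      (tendsto_one_div_add_atTop_nhds_zero_nat (𝕜 := ℝ)).const_mul 2
  have h_ratio (n : ℕ) : (φ n).rOut ≤ 2 * (φ n).rIn := by simp only [φ, mul_one_div, le_refl]
  have h_mem_conv (n : ℕ) := convolution_normed_mem_Icc (φ n) hg_loc h_mem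
  refine ⟨fun n => (φ n).normed volume ⋆[ContinuousLinearMap.lsmul ℝ ℝ, volume] g, fun n => ⟨?_,
    ⟨m, hm, K, h_mem_conv n⟩, exists_norm_gradient_convolution_le (φ n).contDiff_normed
      (φ n).hasCompactSupport_normed hg_loc hK⟩, h_mem_conv,
    ContDiffBump.ae_convolution_tendsto_right_of_locallyIntegrable h_rOut
      (.of_forall h_ratio) hg_loc⟩
  exact (φ n).hasCompactSupport_normed.contDiff_convolution_left _ (φ n).contDiff_normed hg_loc

end Mollification

section ThermostatEntropy

open Filter Topology InformationTheory
open ContinuousLinearMap (adjoint)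

variable {V W Ω : Type*}
  [NormedAddCommGroup V] [InnerProductSpace ℝ V] [FiniteDimensional ℝ V] [MeasurableSpace V]
  [BorelSpace V]
  [NormedAddCommGroup W] [InnerProductSpace ℝ W] [FiniteDimensional ℝ W] [MeasurableSpace W]
  [BorelSpace W] [MeasurableSpace Ω]
  {P : Measure Ω} [IsProbabilityMeasure P] {A : Ω → V →L[ℝ] V} {B : Ω → W →L[ℝ] V}
  {f f' : V → ℝ} {q : ℝ}

namespace IsRegularDensity

lemma integrable_klFun (hf : IsRegularDensity f) :
    Integrable (fun v => klFun (f v)) (gauss V) := by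
  obtain ⟨m, hm, K, h_mem⟩ := hf.exists_mem_Icc
  exact .of_mem_Icc 0 _ (continuous_klFun.comp hf.continuous).aemeasurable (.of_forall fun v =>
    ⟨klFun_nonneg (hf.pos v).le, klFun_le_max_of_mem_Icc hm.le (h_mem v)⟩)

lemma integral_klFun (hf : IsRegularDensity f) :
    ∫ v, klFun (f v) ∂gauss V = gaussEntropy f + 1 - ∫ v, f v ∂gauss V := by
  have h_int : Integrable f (gauss V) := hf.integrable_comp measurable_id
  have h_mul_log (v : V) : f v * Real.log (f v) = klFun (f v) + f v - 1 := by
    rw [klFun_apply]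
    ring
  have h_add : Integrable (fun v => klFun (f v) + f v) (gauss V) := hf.integrable_klFun.add h_int
  simp only [gaussEntropy, h_mul_log]
  rw [integral_sub h_add (integrable_const 1), integral_add hf.integrable_klFun h_int,
    integral_const, probReal_univ, one_smul]
  ring

lemma klEntropy_eq (hf : IsRegularDensity f) :
    klEntropy (gauss V) f = ENNReal.ofReal (∫ v, klFun (f v) ∂gauss V) :=
  (ofReal_integral_eq_lintegral_ofReal hf.integrable_klFun
    (.of_forall fun v => klFun_nonneg (hf.pos v).le)).symm

end IsRegularDensity

namespace IsThermostat

lemma integrable_thermostat (h : IsThermostat A B) (hf : Integrable f (gauss V)) :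
    Integrable (thermostat P A B f) (gauss V) :=
  (h.measurePreserving_affine.integrable_comp_of_integrable hf).integral_prod_left

lemma lintegral_enorm_thermostat_sub_le (h : IsThermostat A B) (hf : Integrable f (gauss V))
    (hf' : Integrable f' (gauss V)) :
    ∫⁻ v, ‖thermostat P A B f v - thermostat P A B f' v‖ₑ ∂gauss V ≤
      ∫⁻ v, ‖f v - f' v‖ₑ ∂gauss V := by
  have h_affine := h.measurePreserving_affine (P := P)
  have h_int {g : V → ℝ} (hg : Integrable g (gauss V)) : Integrable
      (fun x : V × Ω × W => g (A x.2.1 x.1 + B x.2.1 x.2.2)) ((gauss V).prod (P.prod (gauss W))) :=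
    h_affine.integrable_comp_of_integrable hg
  have h_sub := (hf.sub hf').aestronglyMeasurable
  calc _ ≤ ∫⁻ v, ∫⁻ p, ‖(f - f') (A p.1 v + B p.1 p.2)‖ₑ ∂P.prod (gauss W) ∂gauss V := by
        refine lintegral_mono_ae ?_
        filter_upwards [(h_int hf).prod_right_ae, (h_int hf').prod_right_ae] with v hv hv'
        rw [thermostat, thermostat, ← integral_sub hv hv']
        exact enorm_integral_le_lintegral_enorm _
    _ = ∫⁻ x, ‖(f - f') (A x.2.1 x.1 + B x.2.1 x.2.2)‖ₑ ∂(gauss V).prod (P.prod (gauss W)) :=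
        (lintegral_prod _ (h_int (hf.sub hf')).aestronglyMeasurable.enorm).symm
    _ = ∫⁻ v, ‖(f - f') v‖ₑ ∂gauss V := by
        have h_enorm : AEMeasurable (fun v => ‖(f - f') v‖ₑ) (gauss V) := h_sub.enorm
        rw [← h_affine.map_eq] at h_enorm
        rw [← lintegral_map' h_enorm h_affine.aemeasurable, h_affine.map_eq]

lemma klEntropy_thermostat_le_of_tendsto (h : IsThermostat A B) {u : ℕ → V → ℝ}
    {c : ℕ → ENNReal} (hf : Integrable f (gauss V)) (hu : ∀ n, Integrable (u n) (gauss V))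
    (h_lim : Tendsto (fun n => ∫⁻ v, ‖u n v - f v‖ₑ ∂gauss V) atTop (𝓝 0))
    (h_le : ∀ n, klEntropy (gauss V) (thermostat P A B (u n)) ≤
      ENNReal.ofReal q * c n + ENNReal.ofReal ((1 - q) * klFun (∫ v, u n v ∂gauss V)))
    (hc : Tendsto c atTop (𝓝 (klEntropy (gauss V) f))) :
    klEntropy (gauss V) (thermostat P A B f) ≤ ENNReal.ofReal q * klEntropy (gauss V) f +
      ENNReal.ofReal ((1 - q) * klFun (∫ v, f v ∂gauss V)) := by
  have h_integral := tendsto_integral_of_L1 f hf.aestronglyMeasurable (.of_forall hu) h_lim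
  have h_lim_thermostat : Tendsto
      (fun n => ∫⁻ v, ‖thermostat P A B (u n) v - thermostat P A B f v‖ₑ ∂gauss V) atTop (𝓝 0) :=
    tendsto_of_tendsto_of_tendsto_of_le_of_le tendsto_const_nhds h_lim (fun _ => zero_le)
      fun n => h.lintegral_enorm_thermostat_sub_le (hu n) hf
  refine klEntropy_le_of_tendsto (fun n => (h.integrable_thermostat (hu n)).aestronglyMeasurable)
    (h.integrable_thermostat hf).aestronglyMeasurable h_lim_thermostat h_le
    ((ENNReal.Tendsto.const_mul hc (.inr ENNReal.ofReal_ne_top)).add ?_)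
  exact ENNReal.tendsto_ofReal (((continuous_klFun.tendsto _).comp h_integral).const_mul (1 - q))

lemma klEntropy_thermostat_le_of_isRegularDensity (h : IsThermostat A B)
    (hf : IsRegularDensity f) (hq : ∀ ξ, ∫ ω, ‖adjoint (A ω) ξ‖ ^ 2 ∂P = q * ‖ξ‖ ^ 2) :
    klEntropy (gauss V) (thermostat P A B f) ≤ ENNReal.ofReal q * klEntropy (gauss V) f +
      ENNReal.ofReal ((1 - q) * klFun (∫ v, f v ∂gauss V)) := by
  have h_le := h.gaussEntropy_thermostat_le hf hq
  have h_nonneg : 0 ≤ ∫ v, klFun (f v) ∂gauss V :=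
    integral_nonneg fun v => klFun_nonneg (hf.pos v).le
  have h_int : Integrable f (gauss V) := hf.integrable_comp measurable_id
  rw [(h.isRegularDensity hf).klEntropy_eq, hf.klEntropy_eq, ← ENNReal.ofReal_mul' h_nonneg]
  refine (ENNReal.ofReal_le_ofReal ?_).trans ENNReal.ofReal_add_le
  rw [(h.isRegularDensity hf).integral_klFun, hf.integral_klFun, h.integral_thermostat h_int,
    klFun_apply]
  linarith

lemma klEntropy_thermostat_le_of_mem_Icc (h : IsThermostat A B) {m K : ℝ} (hm : 0 < m)
    (hf : AEStronglyMeasurable f volume) (h_mem : ∀ v, f v ∈ Set.Icc m K)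
    (hq : ∀ ξ, ∫ ω, ‖adjoint (A ω) ξ‖ ^ 2 ∂P = q * ‖ξ‖ ^ 2) :
    klEntropy (gauss V) (thermostat P A B f) ≤ ENNReal.ofReal q * klEntropy (gauss V) f +
      ENNReal.ofReal ((1 - q) * klFun (∫ v, f v ∂gauss V)) := by
  obtain ⟨u, hu, hu_mem, hu_lim⟩ := exists_isRegularDensity_tendsto hf hm h_mem
  replace hu_lim := gauss_absolutelyContinuous.ae_le hu_lim
  replace hf := hf.mono_ac gauss_absolutelyContinuous
  have hf_int : Integrable f (gauss V) := .of_mem_Icc m K hf.aemeasurable (.of_forall h_mem)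
  have hu_meas (n : ℕ) : AEStronglyMeasurable (u n) (gauss V) :=
    (hu n).continuous.aestronglyMeasurable
  refine h.klEntropy_thermostat_le_of_tendsto hf_int
    (fun n => (hu n).integrable_comp measurable_id) ?_
    (fun n => h.klEntropy_thermostat_le_of_isRegularDensity (hu n) hq)
    (tendsto_klEntropy_of_mem_Icc hm.le hu_meas hu_mem hu_lim)
  refine tendsto_lintegral_enorm_sub hu_meas hf (integrable_const (K - m))
    (fun n => .of_forall fun v => ?_) hu_lim
  exact (dist_eq_norm _ _).symm.trans_le (Real.dist_le_of_mem_Icc (hu_mem n v) (h_mem v))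

lemma klEntropy_thermostat_le (h : IsThermostat A B) (hf : Integrable f (gauss V))
    (hf_nonneg : 0 ≤ᵐ[gauss V] f)
    (hq : ∀ ξ, ∫ ω, ‖adjoint (A ω) ξ‖ ^ 2 ∂P = q * ‖ξ‖ ^ 2) :
    klEntropy (gauss V) (thermostat P A B f) ≤ ENNReal.ofReal q * klEntropy (gauss V) f +
      ENNReal.ofReal ((1 - q) * klFun (∫ v, f v ∂gauss V)) := by
  let a (n : ℕ) : ℝ := 1 / ((n : ℝ) + 1)
  let b (n : ℕ) : ℝ := (n : ℝ) + 1
  have ha (n : ℕ) : 0 < a n := by positivity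
  have hb (n : ℕ) : 1 ≤ b n := by simp only [b, le_add_iff_nonneg_left, Nat.cast_nonneg]
  have ha_le (n : ℕ) : a n ≤ 1 := div_le_one_of_le₀ (hb n) (zero_le_one.trans (hb n))
  let u (n : ℕ) (v : V) : ℝ := max (a n) (min (f v) (b n))
  have hu_meas {τ : Measure V} (hτ : AEStronglyMeasurable f τ) (n : ℕ) :
      AEStronglyMeasurable (u n) τ :=
    Continuous.comp_aestronglyMeasurable (g := fun y : ℝ => max (a n) (min y (b n)))
      (by fun_prop) hτ
  have hu_mem (n : ℕ) (v : V) : u n v ∈ Set.Icc (a n) (b n) :=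
    ⟨le_max_left _ _, max_le ((ha_le n).trans (hb n)) (min_le_right _ _)⟩
  have hu_lim (v : V) (hv : 0 ≤ f v) : Tendsto (fun n => u n v) atTop (𝓝 (f v)) := by
    have h_min : ∀ᶠ n : ℕ in atTop, min (f v) (b n) = f v := by
      filter_upwards [eventually_ge_atTop ⌈f v⌉₊] with n hn
      exact min_eq_left ((Nat.ceil_le.1 hn).trans (lt_add_one _).le)
    simpa only [max_eq_right hv] using (tendsto_one_div_add_atTop_nhds_zero_nat (𝕜 := ℝ)).max
      (tendsto_const_nhds.congr' (h_min.mono fun _ hn => hn.symm))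
  have hf_vol := hf.aestronglyMeasurable.mono_ac absolutelyContinuous_gauss
  refine h.klEntropy_thermostat_le_of_tendsto hf (fun n => .of_mem_Icc (a n) (b n)
      (hu_meas hf.aestronglyMeasurable n).aemeasurable (.of_forall (hu_mem n))) ?_
    (fun n => (h.klEntropy_thermostat_le_of_mem_Icc (ha n) (hu_meas hf_vol n) (hu_mem n) hq).trans
      (by gcongr; exact klEntropy_clamp_le (ha_le n) (hb n) hf_nonneg)) tendsto_const_nhds
  exact tendsto_lintegral_enorm_sub (hu_meas hf.aestronglyMeasurable) hf.aestronglyMeasurable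
    (hf.add (integrable_const 1))
    (fun n => hf_nonneg.mono fun v hv => norm_clamp_sub_le (ha n).le (ha_le n) hv)
    (hf_nonneg.mono hu_lim)

end IsThermostat

end ThermostatEntropy

section CompoundPoisson

open Measure
open scoped NNReal ENNReal Nat

variable {G : Type*} [Monoid G] [MeasurableSpace G]

/-- The `n`-fold multiplicative convolution power of `β`: the law of `g₁ ⋯ gₙ` for independent
factors of law `β`. -/
def convPow (β : Measure G) : ℕ → Measure G
  | 0 => dirac 1
  | n + 1 => convPow β n ∗ₘ β

/-- The convolution exponential `∑ₙ β^{∗n} / n!`. -/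
def convExp (β : Measure G) : Measure G := Measure.sum fun n => (n ! : ℝ≥0)⁻¹ • convPow β n

/-- The compound Poisson law `e^{-β(G)} ∑ₙ β^{∗n} / n!`: the law of the product of a Poisson number
of independent jumps when the jump `g` arrives at the rate `β(dg)`. -/
def compoundPoisson (β : Measure G) : Measure G :=
  (Real.exp (-β.real Set.univ)).toNNReal • convExp β

variable [MeasurableMul₂ G] {β : Measure G} [IsFiniteMeasure β]

instance isFiniteMeasure_convPow (n : ℕ) : IsFiniteMeasure (convPow β n) := by
  induction n with
  | zero => exact inferInstanceAs (IsFiniteMeasure (dirac 1))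
  | succ n ih => exact inferInstanceAs (IsFiniteMeasure (convPow β n ∗ₘ β))

lemma integral_convPow {ψ : G → ℝ} {b C : ℝ} (hψ : Measurable ψ) (hC : ∀ g, ‖ψ g‖ ≤ C)
    (hb : ∀ g, ∫ h, ψ (g * h) ∂β = b * ψ g) (n : ℕ) :
    ∫ g, ψ g ∂convPow β n = b ^ n * ψ 1 := by
  induction n with
  | zero => simp [convPow, integral_dirac' _ _ hψ.stronglyMeasurable]
  | succ n ih =>
    rw [convPow, integral_mconv (.of_bound hψ.aestronglyMeasurable C (ae_of_all _ hC))]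
    simp only [hb, integral_const_mul, ih, pow_succ', mul_assoc]

lemma measureReal_univ_convPow (n : ℕ) : (convPow β n).real Set.univ = β.real Set.univ ^ n := by
  simpa using integral_convPow (β := β) (ψ := fun _ => 1) (b := β.real Set.univ) measurable_const
    (fun _ => le_rfl) (by simp) n

instance isFiniteMeasure_convExp : IsFiniteMeasure (convExp β) := by
  refine ⟨?_⟩
  have h_mass (n : ℕ) : ((n ! : ℝ≥0)⁻¹ • convPow β n) Set.univ
      = ENNReal.ofReal (β.real Set.univ ^ n / n !) := by
    rw [← ofReal_measureReal, measureReal_nnreal_smul_apply, measureReal_univ_convPow]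
    simp [div_eq_inv_mul]
  rw [convExp, Measure.sum_apply _ .univ, tsum_congr h_mass, ← ENNReal.ofReal_tsum_of_nonneg
    (fun n => by positivity) (Real.summable_pow_div_factorial _)]
  exact ENNReal.ofReal_lt_top

lemma integral_compoundPoisson {ψ : G → ℝ} {b C : ℝ} (hψ : Measurable ψ) (hC : ∀ g, ‖ψ g‖ ≤ C)
    (hb : ∀ g, ∫ h, ψ (g * h) ∂β = b * ψ g) :
    ∫ g, ψ g ∂compoundPoisson β = Real.exp (b - β.real Set.univ) * ψ 1 := by
  have h_exp : HasSum (fun n : ℕ => b ^ n / n ! * ψ 1) (Real.exp b * ψ 1) := by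
    rw [Real.exp_eq_exp_ℝ]
    exact (NormedSpace.expSeries_div_hasSum_exp b).mul_right _
  have h_sum := hasSum_integral_measure (f := ψ) (μ := fun n : ℕ => (n ! : ℝ≥0)⁻¹ • convPow β n)
    (.of_bound (μ := convExp β) hψ.aestronglyMeasurable C (ae_of_all _ hC))
  simp only [integral_smul_nnreal_measure, integral_convPow hψ hC hb, NNReal.smul_def, smul_eq_mul,
    NNReal.coe_inv, NNReal.coe_natCast, ← mul_assoc, ← div_eq_inv_mul] at h_sum
  rw [compoundPoisson, integral_smul_nnreal_measure, convExp, h_sum.unique h_exp, NNReal.smul_def,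
    Real.coe_toNNReal _ (Real.exp_pos _).le, smul_eq_mul, ← mul_assoc, ← Real.exp_add,
    neg_add_eq_sub]

instance isProbabilityMeasure_compoundPoisson : IsProbabilityMeasure (compoundPoisson β) := by
  refine isProbabilityMeasure_iff_real.2 ?_
  simpa using integral_compoundPoisson (β := β) (ψ := fun _ => 1) (b := β.real Set.univ)
    measurable_const (fun _ => le_rfl) (by simp)

end CompoundPoisson

section GroupAverage

open Measure Filter Topology
open scoped NNReal Nat

variable {G X : Type*} [Monoid G] [MeasurableSpace G] [MeasurableSpace X] [MulAction G X]
  {μ : Measure X} {ρ ρ' : Measure G} {T T' : (X →₁[μ] ℝ) →L[ℝ] (X →₁[μ] ℝ)}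

/-- `T` averages integrable functions over the action of random elements of `G` of law `ρ`. -/
def IsGroupAverage (ρ : Measure G) (T : (X →₁[μ] ℝ) →L[ℝ] (X →₁[μ] ℝ)) : Prop :=
  ∀ F : X →₁[μ] ℝ, T F =ᵐ[μ] fun x => ∫ g, F (g • x) ∂ρ

lemma measurePreserving_smul_skew [MeasurableSMul₂ G X] [SFinite μ] [SMulInvariantMeasure G X μ]
    (ρ : Measure G) [SFinite ρ] :
    MeasurePreserving (fun p : G × X => (p.1, p.1 • p.2)) (ρ.prod μ) (ρ.prod μ) :=
  (MeasurePreserving.id ρ).skew_product measurable_smul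
    (ae_of_all _ fun g => MeasureTheory.map_smul g μ)

lemma ae_ae_smul [MeasurableSMul₂ G X] [SFinite μ] [SMulInvariantMeasure G X μ]
    (ρ : Measure G) [SFinite ρ] {p : X → Prop} (hp : ∀ᵐ x ∂μ, p x) :
    ∀ᵐ x ∂μ, ∀ᵐ g ∂ρ, p (g • x) := by
  have h_snd : ∀ᵐ q ∂ρ.prod μ, p q.2 := Measure.quasiMeasurePreserving_snd.ae hp
  exact Measure.ae_ae_of_ae_prod (measurePreserving_swap.quasiMeasurePreserving.ae
    ((measurePreserving_smul_skew ρ).quasiMeasurePreserving.ae h_snd))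

lemma integrable_smul_prod [MeasurableSMul₂ G X] [SFinite μ] [SMulInvariantMeasure G X μ]
    (ρ : Measure G) [IsFiniteMeasure ρ] {F : X → ℝ} (hF : Integrable F μ) :
    Integrable (fun p : G × X => F (p.1 • p.2)) (ρ.prod μ) :=
  (measurePreserving_smul_skew ρ).integrable_comp_of_integrable (g := fun p => F p.2)
    (hF.comp_snd ρ)

lemma ae_integrable_smul [MeasurableSMul₂ G X] [SFinite μ] [SMulInvariantMeasure G X μ]
    (ρ : Measure G) [IsFiniteMeasure ρ] {F : X → ℝ} (hF : Integrable F μ) :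
    ∀ᵐ x ∂μ, Integrable (fun g => F (g • x)) ρ :=
  (integrable_smul_prod ρ hF).prod_left_ae

namespace IsGroupAverage

lemma nnreal_smul (h : IsGroupAverage ρ T) (c : ℝ≥0) : IsGroupAverage (c • ρ) ((c : ℝ) • T) := by
  intro F
  filter_upwards [h F, Lp.coeFn_smul (c : ℝ) (T F)] with x hx hcx
  rw [integral_smul_nnreal_measure, _root_.smul_apply, hcx, Pi.smul_apply, hx,
    NNReal.smul_def]

lemma one [MeasurableSMul G X] :
    IsGroupAverage (dirac (1 : G)) (1 : (X →₁[μ] ℝ) →L[ℝ] (X →₁[μ] ℝ)) := by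
  refine fun F => ae_of_all _ fun x => ?_
  have h_meas := (Lp.stronglyMeasurable F).comp_measurable (measurable_smul_const (M := G) x)
  exact ((integral_dirac' _ 1 h_meas).trans (congrArg F (one_smul G x))).symm

variable [MeasurableSMul₂ G X] [SFinite μ] [SMulInvariantMeasure G X μ]

lemma mul [MeasurableMul₂ G] [IsFiniteMeasure ρ] [IsFiniteMeasure ρ'] (h : IsGroupAverage ρ T)
    (h' : IsGroupAverage ρ' T') : IsGroupAverage (ρ' ∗ₘ ρ) (T * T') := by
  intro F
  filter_upwards [h (T' F), ae_ae_smul ρ (h' F),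
    ae_integrable_smul (ρ' ∗ₘ ρ) (L1.integrable_coeFn F)] with x hx hx' hx_int
  have h_prod : Integrable (fun p : G × G => F ((p.1 * p.2) • x)) (ρ'.prod ρ) :=
    (integrable_map_measure hx_int.1 measurable_mul.aemeasurable).1 hx_int
  rw [mul_apply_eq_comp, hx, integral_congr_ae hx', Measure.mconv,
    integral_map measurable_mul.aemeasurable hx_int.1, integral_prod_symm _ h_prod]
  simp only [mul_smul]

lemma hasSum {ι : Type*} [Countable ι] {ρ : ι → Measure G} [IsFiniteMeasure (Measure.sum ρ)]
    {T : ι → (X →₁[μ] ℝ) →L[ℝ] (X →₁[μ] ℝ)} {S : (X →₁[μ] ℝ) →L[ℝ] (X →₁[μ] ℝ)}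
    (h : ∀ i, IsGroupAverage (ρ i) (T i)) (hS : HasSum T S) : IsGroupAverage (Measure.sum ρ) S := by
  intro F
  have h_lim : Tendsto (fun s => (∑ i ∈ s, T i) F) atTop (𝓝 (S F)) :=
    ((ContinuousLinearMap.apply ℝ _ F).continuous.tendsto S).comp hS
  obtain ⟨s, hs, h_ae⟩ := (tendstoInMeasure_of_tendsto_Lp h_lim).exists_seq_tendsto_ae'
  have h_partial : ∀ᵐ x ∂μ, ∀ n, (∑ i ∈ s n, T i) F x = ∑ i ∈ s n, ∫ g, F (g • x) ∂ρ i := by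
    refine ae_all_iff.2 fun n => ?_
    filter_upwards [Lp.coeFn_finsetSum (s n) fun i => T i F, ae_all_iff.2 fun i => h i F]
      with x hx hi
    rw [_root_.sum_apply, hx, Finset.sum_apply, Finset.sum_congr rfl fun i _ => hi i]
  filter_upwards [h_ae, h_partial, ae_integrable_smul (Measure.sum ρ) (L1.integrable_coeFn F)]
    with x hx hx_partial hx_int
  simp only [hx_partial] at hx
  exact tendsto_nhds_unique hx ((hasSum_integral_measure hx_int).comp hs)

lemma pow [MeasurableMul₂ G] [IsFiniteMeasure ρ] (h : IsGroupAverage ρ T) (n : ℕ) :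
    IsGroupAverage (convPow ρ n) (T ^ n) := by
  induction n with
  | zero => exact one
  | succ n ih => rw [pow_succ']; exact h.mul ih

lemma exp [MeasurableMul₂ G] [IsFiniteMeasure ρ] (h : IsGroupAverage ρ T) :
    IsGroupAverage (convExp ρ) (NormedSpace.exp T) := by
  have : IsFiniteMeasure (Measure.sum fun n => (n ! : ℝ≥0)⁻¹ • convPow ρ n) :=
    isFiniteMeasure_convExp
  refine hasSum (fun n => (h.pow n).nnreal_smul _) ?_
  simpa using NormedSpace.exp_series_hasSum_exp' (𝕂 := ℝ) T

lemma exp_sub_smul_one [MeasurableMul₂ G] [IsFiniteMeasure ρ] (h : IsGroupAverage ρ T) :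
    IsGroupAverage (compoundPoisson ρ) (NormedSpace.exp (T - ρ.real Set.univ • 1)) := by
  have h_scalar : NormedSpace.exp (T - ρ.real Set.univ • 1)
      = Real.exp (-ρ.real Set.univ) • NormedSpace.exp T := by
    let : NormedAlgebra ℚ ((X →₁[μ] ℝ) →L[ℝ] (X →₁[μ] ℝ)) := .restrictScalars ℚ ℝ _
    rw [sub_eq_add_neg, ← neg_smul, ← Algebra.algebraMap_eq_smul_one,
      NormedSpace.exp_add_of_commute (Algebra.commutes _ T).symm, ← NormedSpace.algebraMap_exp_comm,
      ← Real.exp_eq_exp_ℝ, Algebra.algebraMap_eq_smul_one, mul_smul_comm, mul_one]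
  have h_smul := h.exp.nnreal_smul (Real.exp (-ρ.real Set.univ)).toNNReal
  rwa [Real.coe_toNNReal _ (Real.exp_pos _).le, ← h_scalar] at h_smul

end IsGroupAverage

end GroupAverage

section OrthogonalAction

open scoped NNReal

lemma rotInv_rotInv_neg {κ : Type*} [DecidableEq κ] {i j : κ} (hij : i ≠ j) (θ : ℝ) (x : κ → ℝ) :
    rotInv i j θ (rotInv i j (-θ) x) = x := by
  have h_trig := Real.sin_sq_add_cos_sq θ
  ext k
  by_cases hi : k = i
  · subst hi
    simp only [rotInv, if_true, if_neg hij.symm, Real.cos_neg, Real.sin_neg]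
    linear_combination x k * h_trig
  by_cases hj : k = j
  · subst hj
    simp only [rotInv, if_true, if_neg hij.symm, Real.cos_neg, Real.sin_neg]
    linear_combination x k * h_trig
  · simp only [rotInv, if_neg hi, if_neg hj]

variable {ι : Type*} [Fintype ι]

variable (ι) in
/-- The orthogonal group of `ℝ^ι`, as a group of operators; its topology and its Borel structure
are those of the operator norm. -/
abbrev OrthGroup : Type _ := unitary (EuclideanSpace ℝ ι →L[ℝ] EuclideanSpace ℝ ι)

instance : SMul (OrthGroup ι) (ι → ℝ) where
  smul g x := ((g : EuclideanSpace ℝ ι →L[ℝ] EuclideanSpace ℝ ι) (WithLp.toLp 2 x)).ofLp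

instance : MulAction (OrthGroup ι) (ι → ℝ) where
  one_smul _ := rfl
  mul_smul _ _ _ := rfl

lemma smul_def (g : OrthGroup ι) (x : ι → ℝ) :
    g • x = ((g : EuclideanSpace ℝ ι →L[ℝ] EuclideanSpace ℝ ι) (WithLp.toLp 2 x)).ofLp :=
  rfl

lemma sum_sq_smul (g : OrthGroup ι) (x : ι → ℝ) : ∑ k, (g • x) k ^ 2 = ∑ k, x k ^ 2 := by
  have h_norm := Unitary.norm_map g (WithLp.toLp 2 x)
  rw [← sq_eq_sq₀ (norm_nonneg _) (norm_nonneg _), EuclideanSpace.real_norm_sq_eq,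
    EuclideanSpace.real_norm_sq_eq] at h_norm
  exact h_norm

instance : MeasurableSMul₂ (OrthGroup ι) (ι → ℝ) where
  measurable_smul :=
    (PiLp.volume_preserving_ofLp ι).measurable.comp
      (isBoundedBilinearMap_apply.continuous.measurable.comp
        ((measurable_subtype_coe.comp measurable_fst).prodMk
          ((PiLp.volume_preserving_toLp ι).measurable.comp measurable_snd)))

instance : SMulInvariantMeasure (OrthGroup ι) (ι → ℝ) volume where
  measure_preimage_smul g _ hs :=
    (((PiLp.volume_preserving_ofLp ι).comp
      ((Unitary.linearIsometryEquiv g).measurePreserving.comp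
        (PiLp.volume_preserving_toLp ι))).measure_preimage hs.nullMeasurableSet)

/-- The quadratic form `∑ₖ dₖ xₖ²`. -/
def diagForm (d x : ι → ℝ) : ℝ := ∑ k, d k * x k ^ 2

lemma measurable_diagForm_inv_smul (d x : ι → ℝ) :
    Measurable fun g : OrthGroup ι => diagForm d (g⁻¹ • x) := by
  have h_diagForm : Measurable (diagForm d) := by unfold diagForm; fun_prop
  have h_inv : Measurable fun g : OrthGroup ι => g⁻¹ :=
    ((ContinuousLinearMap.adjoint.continuous.comp continuous_subtype_val).subtype_mk _).measurable
  exact h_diagForm.comp (measurable_smul.comp (h_inv.prodMk measurable_const))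

lemma norm_diagForm_smul_le (d x : ι → ℝ) (g : OrthGroup ι) :
    ‖diagForm d (g • x)‖ ≤ (∑ k, |d k|) * ∑ k, x k ^ 2 := by
  rw [← sum_sq_smul g x, Finset.sum_mul]
  refine (norm_sum_le _ _).trans (Finset.sum_le_sum fun k _ => ?_)
  rw [norm_mul, Real.norm_eq_abs, Real.norm_eq_abs, abs_sq]
  gcongr
  exact Finset.single_le_sum (fun l _ => sq_nonneg ((g • x) l)) (Finset.mem_univ k)

variable [DecidableEq ι] {i j : ι}

/-- The rotation `r_{ij}(θ)⁻¹` as an element of the orthogonal group. -/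
def rotation (hij : i ≠ j) (θ : ℝ) : OrthGroup ι :=
  Unitary.linearIsometryEquiv.symm <|
    LinearIsometry.toLinearIsometryEquiv
      { rotInvLin i j θ with
        norm_map' := fun x => by
          rw [EuclideanSpace.norm_eq, EuclideanSpace.norm_eq]
          congr 1
          simpa [rotInvLin] using sum_sq_rotInv hij θ x.ofLp } rfl

lemma rotation_smul (hij : i ≠ j) (θ : ℝ) (x : ι → ℝ) : rotation hij θ • x = rotInv i j θ x :=
  rfl

lemma rotation_inv_smul (hij : i ≠ j) (θ : ℝ) (x : ι → ℝ) :
    (rotation hij θ)⁻¹ • x = rotInv i j (-θ) x := by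
  rw [inv_smul_eq_iff, rotation_smul, rotInv_rotInv_neg hij]

lemma measurable_rotation (hij : i ≠ j) : Measurable (rotation hij) := by
  refine (Continuous.subtype_mk (continuous_clm_apply.2 fun x => ?_) _).measurable
  refine (PiLp.continuous_toLp 2 _).comp (continuous_pi fun k => ?_)
  change Continuous fun θ => rotInv i j θ x.ofLp k
  simp only [rotInv]
  split_ifs <;> fun_prop

lemma diagForm_rotInv (hij : i ≠ j) (d x : ι → ℝ) (θ : ℝ) :
    diagForm d (rotInv i j θ x) = diagForm d x
      - (d i - d j) * (x i ^ 2 - x j ^ 2) * Real.sin θ ^ 2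
      - 2 * (d i - d j) * (x i * x j) * (Real.sin θ * Real.cos θ) := by
  have h_pair : ∑ k ∈ ({i, j} : Finset ι), d k * (rotInv i j θ x k ^ 2 - x k ^ 2)
      = ∑ k, d k * (rotInv i j θ x k ^ 2 - x k ^ 2) := by
    refine Finset.sum_subset (Finset.subset_univ _) fun k _ hk => ?_
    simp only [Finset.mem_insert, Finset.mem_singleton, not_or] at hk
    simp only [rotInv, if_neg hk.1, if_neg hk.2, sub_self, mul_zero]
  simp only [Finset.sum_pair hij, mul_sub, Finset.sum_sub_distrib] at h_pair
  have h_i : rotInv i j θ x i = x i * Real.cos θ - x j * Real.sin θ := if_pos rfl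
  have h_j : rotInv i j θ x j = x i * Real.sin θ + x j * Real.cos θ := by
    rw [rotInv, if_neg hij.symm, if_pos rfl]
  rw [h_i, h_j] at h_pair
  have h_trig := Real.sin_sq_add_cos_sq θ
  simp only [diagForm]
  linear_combination (d i * x i ^ 2 + d j * x j ^ 2) * h_trig - h_pair

variable (ν : Measure ℝ) [IsProbabilityMeasure ν]

lemma isGroupAverage_collision (hij : i ≠ j) :
    IsGroupAverage (ν.map (rotation hij)) (collision ν i j hij) := by
  intro F
  have : IsProbabilityMeasure (ν.map (rotation hij)) :=
    Measure.isProbabilityMeasure_map (measurable_rotation hij).aemeasurable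
  filter_upwards [coeFn_collision ν i j hij F,
    ae_integrable_smul (ν.map (rotation hij)) (L1.integrable_coeFn F)] with x hx hx_int
  rw [hx, integral_map (measurable_rotation hij).aemeasurable hx_int.1]
  rfl

lemma integral_diagForm_inv_smul_rotation (hν : ∫ θ, Real.sin θ * Real.cos θ ∂ν = 0) (hij : i ≠ j)
    (d x : ι → ℝ) :
    ∫ g, diagForm d (g⁻¹ • x) ∂ν.map (rotation hij)
      = diagForm d x - (d i - d j) * (x i ^ 2 - x j ^ 2) * ∫ θ, Real.sin θ ^ 2 ∂ν := by
  have h_sin_sq : Integrable (fun θ => Real.sin θ ^ 2) ν :=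
    .of_bound (by fun_prop) 1 (ae_of_all _ fun θ => by
      rw [norm_pow, sq_le_one_iff₀ (norm_nonneg _)]; exact Real.abs_sin_le_one θ)
  have h_sin_cos : Integrable (fun θ => Real.sin θ * Real.cos θ) ν :=
    .of_bound (by fun_prop) 1 (ae_of_all _ fun θ => by
      rw [norm_mul]
      exact mul_le_one₀ (Real.abs_sin_le_one θ) (norm_nonneg _) (Real.abs_cos_le_one θ))
  have h_int : Integrable (fun θ => diagForm d x
      - (d i - d j) * (x i ^ 2 - x j ^ 2) * Real.sin θ ^ 2) ν :=
    (integrable_const _).sub (h_sin_sq.const_mul _)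
  rw [integral_map (measurable_rotation hij).aemeasurable
    (measurable_diagForm_inv_smul d x).aestronglyMeasurable]
  simp only [rotation_inv_smul, diagForm_rotInv hij, Real.sin_neg, Real.cos_neg, neg_sq, neg_mul,
    mul_neg, sub_neg_eq_add]
  rw [integral_add h_int (h_sin_cos.const_mul _),
    integral_sub (integrable_const _) (h_sin_sq.const_mul _)]
  simp only [integral_const_mul, hν, integral_const, probReal_univ, one_smul, mul_zero, add_zero]

end OrthogonalAction

section KacWalk

open scoped NNReal

variable {ι α : Type*} [Fintype ι] [DecidableEq ι] [Fintype α] (ν : Measure ℝ)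
  [IsProbabilityMeasure ν] {I J : α → ι} (hIJ : ∀ a, I a ≠ J a) (c : α → ℝ≥0)

/-- The jump intensity of the random walk on the orthogonal group in which, independently for each
`a`, the pair `I a, J a` collides at rate `c a`, with scattering angles distributed by `ν`. -/
def jumpIntensity : Measure (OrthGroup ι) := ∑ a, c a • ν.map (rotation (hIJ a))

instance isFiniteMeasure_jumpIntensity : IsFiniteMeasure (jumpIntensity ν hIJ c) := by
  unfold jumpIntensity
  infer_instance

lemma jumpIntensity_real_univ : (jumpIntensity ν hIJ c).real Set.univ = ∑ a, (c a : ℝ) := by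
  have (a : α) : IsProbabilityMeasure (ν.map (rotation (hIJ a))) :=
    Measure.isProbabilityMeasure_map (measurable_rotation (hIJ a)).aemeasurable
  simp [jumpIntensity, measureReal_def, Measure.finsetSum_apply, ENNReal.toReal_sum]

lemma isGroupAverage_jumpIntensity : IsGroupAverage (jumpIntensity ν hIJ c)
    (∑ a, (c a : ℝ) • collision ν (I a) (J a) (hIJ a)) := by
  have h_fin := isFiniteMeasure_jumpIntensity ν hIJ c
  rw [jumpIntensity, ← Measure.sum_fintype] at h_fin ⊢
  exact .hasSum (fun a => (isGroupAverage_collision ν (hIJ a)).nnreal_smul (c a))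
    (hasSum_fintype _)

lemma isGroupAverage_exp_sum_collision_sub_id :
    IsGroupAverage (compoundPoisson (jumpIntensity ν hIJ c)) (NormedSpace.exp
      (∑ a, (c a : ℝ) • (collision ν (I a) (J a) (hIJ a) - .id ℝ _))) := by
  have h_exp := (isGroupAverage_jumpIntensity ν hIJ c).exp_sub_smul_one
  rw [jumpIntensity_real_univ, Finset.sum_smul, ← Finset.sum_sub_distrib] at h_exp
  simpa only [smul_sub, ContinuousLinearMap.one_def] using h_exp

lemma integral_diagForm_inv_smul_jumpIntensity (hν : ∫ θ, Real.sin θ * Real.cos θ ∂ν = 0)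
    {d : ι → ℝ} {κ : ℝ}
    (hκ : ∀ x : ι → ℝ, ∑ a, c a * ((d (I a) - d (J a)) * (x (I a) ^ 2 - x (J a) ^ 2))
      = κ * diagForm d x) (x : ι → ℝ) :
    ∫ g, diagForm d (g⁻¹ • x) ∂jumpIntensity ν hIJ c
      = (∑ a, (c a : ℝ) - κ * ∫ θ, Real.sin θ ^ 2 ∂ν) * diagForm d x := by
  have (a : α) : IsProbabilityMeasure (ν.map (rotation (hIJ a))) :=
    Measure.isProbabilityMeasure_map (measurable_rotation (hIJ a)).aemeasurable
  have h_int (a : α) : Integrable (fun g => diagForm d (g⁻¹ • x))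
      (c a • ν.map (rotation (hIJ a))) :=
    .of_bound (measurable_diagForm_inv_smul d x).aestronglyMeasurable _
      (ae_of_all _ fun g => norm_diagForm_smul_le d x g⁻¹)
  rw [jumpIntensity, integral_finsetSum_measure fun a _ => h_int a]
  simp only [integral_smul_nnreal_measure, integral_diagForm_inv_smul_rotation ν hν,
    NNReal.smul_def, smul_eq_mul]
  rw [sub_mul, mul_right_comm, ← hκ x, Finset.sum_mul, Finset.sum_mul, ← Finset.sum_sub_distrib]
  exact Finset.sum_congr rfl fun a _ => by ring

lemma integral_diagForm_inv_smul_compoundPoisson (hν : ∫ θ, Real.sin θ * Real.cos θ ∂ν = 0)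
    {d : ι → ℝ} {κ : ℝ}
    (hκ : ∀ x : ι → ℝ, ∑ a, c a * ((d (I a) - d (J a)) * (x (I a) ^ 2 - x (J a) ^ 2))
      = κ * diagForm d x) (x : ι → ℝ) :
    ∫ g, diagForm d (g⁻¹ • x) ∂compoundPoisson (jumpIntensity ν hIJ c)
      = Real.exp (-(κ * ∫ θ, Real.sin θ ^ 2 ∂ν)) * diagForm d x := by
  have h_step (g : OrthGroup ι) : ∫ h, diagForm d ((g * h)⁻¹ • x) ∂jumpIntensity ν hIJ c
      = (∑ a, (c a : ℝ) - κ * ∫ θ, Real.sin θ ^ 2 ∂ν) * diagForm d (g⁻¹ • x) := by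
    simp only [mul_inv_rev, mul_smul]
    exact integral_diagForm_inv_smul_jumpIntensity ν hIJ c hν hκ (g⁻¹ • x)
  rw [integral_compoundPoisson (measurable_diagForm_inv_smul d x)
    (fun g => norm_diagForm_smul_le d x g⁻¹) h_step, jumpIntensity_real_univ, inv_one, one_smul,
    sub_sub_cancel_left]

end KacWalk

section KacGenerator

open scoped NNReal

variable {M N : ℕ}

/-- The colliding pairs: within the system, within the reservoir, between the two. -/
abbrev PairIndex (M N : ℕ) : Type :=
  {p : Fin M × Fin M // p.1 < p.2} ⊕ ({p : Fin N × Fin N // p.1 < p.2} ⊕ (Fin M × Fin N))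

/-- The first particle of a pair. -/
def pairFst : PairIndex M N → Particle M N
  | .inl p => Sum.inl p.1.1
  | .inr (.inl p) => Sum.inr p.1.1
  | .inr (.inr p) => Sum.inl p.1

/-- The second particle of a pair. -/
def pairSnd : PairIndex M N → Particle M N
  | .inl p => Sum.inl p.1.2
  | .inr (.inl p) => Sum.inr p.1.2
  | .inr (.inr p) => Sum.inr p.2

lemma pairFst_ne_pairSnd : ∀ a : PairIndex M N, pairFst a ≠ pairSnd a
  | .inl p => fun h => p.2.ne (Sum.inl.inj h)
  | .inr (.inl p) => fun h => p.2.ne (Sum.inr.inj h)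
  | .inr (.inr _) => Sum.inl_ne_inr

/-- The collision rate of a pair. -/
def pairRate (lamS lamR mu : ℝ) : PairIndex M N → ℝ
  | .inl _ => lamS / ((M : ℝ) - 1)
  | .inr (.inl _) => lamR / ((N : ℝ) - 1)
  | .inr (.inr _) => mu / (N : ℝ)

lemma pairRate_nonneg {lamS lamR mu : ℝ} (hlamS : 0 ≤ lamS) (hlamR : 0 ≤ lamR) (hmu : 0 ≤ mu) :
    ∀ a : PairIndex M N, 0 ≤ pairRate lamS lamR mu a
  | .inl p => div_nonneg hlamS (by
      have : 1 ≤ M := p.1.1.pos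
      rw [sub_nonneg]; exact_mod_cast this)
  | .inr (.inl p) => div_nonneg hlamR (by
      have : 1 ≤ N := p.1.1.pos
      rw [sub_nonneg]; exact_mod_cast this)
  | .inr (.inr _) => div_nonneg hmu N.cast_nonneg

/-- The coefficients of the energy excess `|𝐯|² - M / (N + M) |𝐱|²` of the system over its
equilibrium share. -/
def excess : Particle M N → ℝ :=
  Sum.elim (fun _ => (N : ℝ) / (N + M)) fun _ => -((M : ℝ) / (N + M))

lemma diagForm_excess (hN : 1 ≤ N) (x : Particle M N → ℝ) :
    diagForm excess x
      = ∑ i, x (Sum.inl i) ^ 2 - M / (N + M) * ∑ k, x k ^ 2 := by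
  have hNM : (N : ℝ) + M ≠ 0 := by positivity
  simp only [diagForm, excess, Fintype.sum_sum_type, Sum.elim_inl, Sum.elim_inr, ← Finset.mul_sum]
  field_simp
  ring

lemma sum_pairRate_mul_excess (lamS lamR mu : ℝ) (hN : 1 ≤ N) (x : Particle M N → ℝ) :
    ∑ a, pairRate lamS lamR mu a * ((excess (pairFst a) - excess (pairSnd a))
        * (x (pairFst a) ^ 2 - x (pairSnd a) ^ 2))
      = mu * (N + M) / N * diagForm excess x := by
  have hN' : (N : ℝ) ≠ 0 := by positivity
  have hNM : (N : ℝ) + M ≠ 0 := by positivity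
  rw [Fintype.sum_sum_type, Fintype.sum_sum_type, Fintype.sum_prod_type]
  simp only [pairFst, pairSnd, pairRate, excess, Sum.elim_inl, Sum.elim_inr, sub_self, zero_mul,
    mul_zero, Finset.sum_const_zero, zero_add, diagForm, Fintype.sum_sum_type, ← Finset.mul_sum,
    Finset.sum_sub_distrib, Finset.sum_const, Finset.card_univ, Fintype.card_fin, nsmul_eq_mul]
  field_simp
  ring

lemma generator_eq_sum (lamS lamR mu : ℝ) (ν : Measure ℝ) [IsProbabilityMeasure ν] :
    generator M N lamS lamR mu ν =
      ∑ a, pairRate lamS lamR mu a • (collision ν (pairFst a) (pairSnd a) (pairFst_ne_pairSnd a)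
        - .id ℝ (State M N)) := by
  rw [Fintype.sum_sum_type, Fintype.sum_sum_type, Fintype.sum_prod_type, generator]
  simp only [Finset.smul_sum, pairRate, pairFst, pairSnd, add_assoc]

/-- The jump intensity, accumulated up to time `t`, of the random walk on the orthogonal group that
underlies Kac's evolution. -/
def kacIntensity (M N : ℕ) (lamS lamR mu : ℝ) (ν : Measure ℝ) [IsProbabilityMeasure ν] (t : ℝ) :
    Measure (OrthGroup (Particle M N)) :=
  jumpIntensity ν pairFst_ne_pairSnd fun a => (t * pairRate lamS lamR mu a).toNNReal

instance isFiniteMeasure_kacIntensity (lamS lamR mu : ℝ) (ν : Measure ℝ) [IsProbabilityMeasure ν]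
    (t : ℝ) : IsFiniteMeasure (kacIntensity M N lamS lamR mu ν t) :=
  isFiniteMeasure_jumpIntensity _ _ _

variable {lamS lamR mu t : ℝ} (ν : Measure ℝ) [IsProbabilityMeasure ν]

lemma isGroupAverage_evolution (hlamS : 0 ≤ lamS) (hlamR : 0 ≤ lamR) (hmu : 0 ≤ mu) (ht : 0 ≤ t) :
    IsGroupAverage (compoundPoisson (kacIntensity M N lamS lamR mu ν t))
      (evolution M N lamS lamR mu ν t) := by
  have h_rate (a : PairIndex M N) : ((t * pairRate lamS lamR mu a).toNNReal : ℝ)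
      = t * pairRate lamS lamR mu a :=
    Real.coe_toNNReal _ (mul_nonneg ht (pairRate_nonneg hlamS hlamR hmu a))
  have h_avg := isGroupAverage_exp_sum_collision_sub_id ν (pairFst_ne_pairSnd (M := M) (N := N))
    fun a => (t * pairRate lamS lamR mu a).toNNReal
  simp only [h_rate, mul_smul, ← Finset.smul_sum, ← generator_eq_sum] at h_avg
  exact h_avg

lemma integral_diagForm_excess_inv_smul (hlamS : 0 ≤ lamS) (hlamR : 0 ≤ lamR) (hmu : 0 ≤ mu)
    (ht : 0 ≤ t) (hN : 1 ≤ N) (hν : ∫ θ, Real.sin θ * Real.cos θ ∂ν = 0) (x : Particle M N → ℝ) :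
    ∫ g, diagForm excess (g⁻¹ • x) ∂compoundPoisson (kacIntensity M N lamS lamR mu ν t)
      = Real.exp (-t * (mu * ∫ θ, Real.sin θ ^ 2 ∂ν) * (N + M) / N) * diagForm excess x := by
  rw [kacIntensity, integral_diagForm_inv_smul_compoundPoisson ν pairFst_ne_pairSnd _ hν
    (κ := t * (mu * (N + M) / N)) fun y => ?_]
  · congr 2
    ring
  · simp only [Real.coe_toNNReal _ (mul_nonneg ht (pairRate_nonneg hlamS hlamR hmu _)), mul_assoc t,
      ← Finset.mul_sum, sum_pairRate_mul_excess lamS lamR mu hN]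

lemma integral_sum_sq_system_inv_smul (hlamS : 0 ≤ lamS) (hlamR : 0 ≤ lamR) (hmu : 0 ≤ mu)
    (ht : 0 ≤ t) (hN : 1 ≤ N) (hν : ∫ θ, Real.sin θ * Real.cos θ ∂ν = 0) {x : Particle M N → ℝ}
    (hx : ∀ j, x (Sum.inr j) = 0) :
    ∫ g, ∑ i, (g⁻¹ • x) (Sum.inl i) ^ 2 ∂compoundPoisson (kacIntensity M N lamS lamR mu ν t)
      = (M / (N + M) + N / (N + M)
        * Real.exp (-t * (mu * ∫ θ, Real.sin θ ^ 2 ∂ν) * (N + M) / N))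
          * ∑ i, x (Sum.inl i) ^ 2 := by
  have hNM : (N : ℝ) + M ≠ 0 := by positivity
  have h_energy : ∑ k, x k ^ 2 = ∑ i, x (Sum.inl i) ^ 2 := by
    simp [Fintype.sum_sum_type, hx]
  have h_split (g : OrthGroup (Particle M N)) : ∑ i, (g⁻¹ • x) (Sum.inl i) ^ 2
      = diagForm excess (g⁻¹ • x) + M / (N + M) * ∑ i, x (Sum.inl i) ^ 2 := by
    rw [diagForm_excess hN, sum_sq_smul, h_energy, sub_add_cancel]
  have h_int : Integrable (fun g => diagForm excess (g⁻¹ • x))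
      (compoundPoisson (kacIntensity M N lamS lamR mu ν t)) :=
    .of_bound (measurable_diagForm_inv_smul _ x).aestronglyMeasurable _
      (ae_of_all _ fun g => norm_diagForm_smul_le _ x g⁻¹)
  simp only [h_split]
  rw [integral_add h_int (integrable_const _), integral_const, probReal_univ, one_smul,
    integral_diagForm_excess_inv_smul ν hlamS hlamR hmu ht hN hν, diagForm_excess hN, h_energy]
  field_simp
  ring

end KacGenerator

section OrthogonalThermostat

open InnerProductSpace
open ContinuousLinearMap (adjoint inl inr)

variable {V W H : Type*}
  [NormedAddCommGroup V] [InnerProductSpace ℝ V] [NormedAddCommGroup W] [InnerProductSpace ℝ W]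
  [NormedAddCommGroup H] [InnerProductSpace ℝ H] [FiniteDimensional ℝ H]

/-- The system component of the image of `(v, w)` under an orthogonal transformation of the total
space `H`, which the isometry `e` identifies with the direct sum of system and reservoir. -/
def systemOutput (e : H ≃ₗᵢ[ℝ] WithLp 2 (V × W)) (g : unitary (H →L[ℝ] H)) : V × W →L[ℝ] V :=
  WithLp.fstL 2 ℝ V W ∘L (e : H →L[ℝ] WithLp 2 (V × W)) ∘L (g : H →L[ℝ] H) ∘L
    (e.symm : WithLp 2 (V × W) →L[ℝ] H) ∘L
      ((WithLp.prodContinuousLinearEquiv 2 ℝ V W).symm : V × W →L[ℝ] WithLp 2 (V × W))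

/-- The block of `g` from the system to itself. -/
abbrev systemBlock (e : H ≃ₗᵢ[ℝ] WithLp 2 (V × W)) (g : unitary (H →L[ℝ] H)) : V →L[ℝ] V :=
  systemOutput e g ∘L inl ℝ V W

/-- The block of `g` from the reservoir to the system. -/
abbrev reservoirBlock (e : H ≃ₗᵢ[ℝ] WithLp 2 (V × W)) (g : unitary (H →L[ℝ] H)) : W →L[ℝ] V :=
  systemOutput e g ∘L inr ℝ V W

variable (e : H ≃ₗᵢ[ℝ] WithLp 2 (V × W))

lemma systemOutput_apply (g : unitary (H →L[ℝ] H)) (p : V × W) :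
    systemOutput e g p = (e ((g : H →L[ℝ] H) (e.symm (WithLp.toLp 2 p)))).fst :=
  rfl

lemma systemBlock_add_reservoirBlock (g : unitary (H →L[ℝ] H)) (v : V) (w : W) :
    systemBlock e g v + reservoirBlock e g w = systemOutput e g (v, w) :=
  ContinuousLinearMap.comp_inl_add_comp_inr _ (v, w)

lemma continuous_systemOutput : Continuous (systemOutput e) := by
  unfold systemOutput
  fun_prop

lemma norm_systemBlock_le (g : unitary (H →L[ℝ] H)) :
    ‖systemBlock e g‖ ≤ 1 := by
  refine ContinuousLinearMap.opNorm_le_bound _ zero_le_one fun v => ?_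
  rw [one_mul, ContinuousLinearMap.comp_apply, systemOutput_apply]
  refine (WithLp.norm_fst_le V _).trans_eq ?_
  rw [e.norm_map, Unitary.norm_map, e.symm.norm_map]
  exact WithLp.norm_toLp_fst 2 V W v

variable [FiniteDimensional ℝ V]

lemma adjoint_systemBlock (g : unitary (H →L[ℝ] H)) :
    adjoint (systemBlock e g) = systemBlock e g⁻¹ := by
  have h_inner (x : WithLp 2 (V × W)) (v : V) :
      ⟪x, WithLp.toLp 2 (v, (0 : W))⟫_ℝ = ⟪x.fst, v⟫_ℝ := by
    simp [WithLp.prod_inner_apply]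
  refine ((ContinuousLinearMap.eq_adjoint_iff _ _).2 fun ξ v => ?_).symm
  calc ⟪systemOutput e g⁻¹ (ξ, 0), v⟫_ℝ
      = ⟪e ((star g : H →L[ℝ] H) (e.symm (WithLp.toLp 2 (ξ, 0)))), WithLp.toLp 2 (v, 0)⟫_ℝ :=
        (h_inner _ v).symm
    _ = ⟪WithLp.toLp 2 (ξ, 0), e ((g : H →L[ℝ] H) (e.symm (WithLp.toLp 2 (v, 0))))⟫_ℝ := by
        rw [← e.symm.inner_map_map, e.symm_apply_apply, ← e.symm.inner_map_map (WithLp.toLp 2 _),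
          e.symm_apply_apply, ContinuousLinearMap.star_eq_adjoint,
          ContinuousLinearMap.adjoint_inner_left]
    _ = ⟪ξ, systemOutput e g (v, 0)⟫_ℝ := by
        rw [real_inner_comm, h_inner, real_inner_comm]
        rfl

variable [FiniteDimensional ℝ W] [MeasurableSpace V] [BorelSpace V] [MeasurableSpace W]
  [BorelSpace W]

lemma measurePreserving_systemOutput (g : unitary (H →L[ℝ] H)) :
    MeasurePreserving (systemOutput e g) ((gauss V).prod (gauss W)) (gauss V) := by
  have h_ofLp : MeasurePreserving WithLp.ofLp (gauss (WithLp 2 (V × W)))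
      ((gauss V).prod (gauss W)) :=
    measurePreserving_gauss_toLp_prod.symm (MeasurableEquiv.toLp 2 (V × W))
  exact (measurePreserving_fst.comp h_ofLp).comp
    ((measurePreserving_gauss_linearIsometryEquiv
      (e.symm.trans ((Unitary.linearIsometryEquiv g).trans e))).comp
        measurePreserving_gauss_toLp_prod)

lemma isThermostat_blocks : IsThermostat (systemBlock e) (reservoirBlock e) where
  measurable_system := ((continuous_systemOutput e).clm_comp_const _).measurable
  measurable_reservoir := ((continuous_systemOutput e).clm_comp_const _).measurable
  norm_le_one := norm_systemBlock_le e
  measurePreserving g := by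
    simpa only [systemBlock_add_reservoirBlock] using measurePreserving_systemOutput e g

end OrthogonalThermostat

section RelativeEntropy

open InformationTheory

variable {n : ℕ} {f : (Fin n → ℝ) → ℝ}

lemma maxwellian_eq_exp_norm_sq (x : Fin n → ℝ) :
    maxwellian x = Real.exp (-Real.pi * ‖WithLp.toLp 2 x‖ ^ 2) := by
  rw [maxwellian, EuclideanSpace.real_norm_sq_eq]

lemma maxwellian_pos (x : Fin n → ℝ) : 0 < maxwellian x := Real.exp_pos _

lemma integral_maxwellian_mul (φ : EuclideanSpace ℝ (Fin n) → ℝ) :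
    ∫ x : Fin n → ℝ, maxwellian x * φ (WithLp.toLp 2 x) = ∫ y, φ y ∂gauss _ := by
  rw [integral_gauss, ← (PiLp.volume_preserving_toLp (Fin n)).integral_comp
    (MeasurableEquiv.toLp 2 (Fin n → ℝ)).measurableEmbedding]
  simp only [maxwellian_eq_exp_norm_sq, smul_eq_mul]

lemma integrable_maxwellian_mul_iff {φ : EuclideanSpace ℝ (Fin n) → ℝ} :
    Integrable (fun x : Fin n → ℝ => maxwellian x * φ (WithLp.toLp 2 x)) ↔
      Integrable φ (gauss _) := by
  rw [integrable_gauss_iff, ← (PiLp.volume_preserving_toLp (Fin n)).integrable_comp_emb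
    (MeasurableEquiv.toLp 2 (Fin n → ℝ)).measurableEmbedding]
  simp only [Function.comp_def, maxwellian_eq_exp_norm_sq]

lemma quasiMeasurePreserving_ofLp_gauss :
    Measure.QuasiMeasurePreserving WithLp.ofLp (gauss (EuclideanSpace ℝ (Fin n))) volume :=
  (PiLp.volume_preserving_ofLp (Fin n)).quasiMeasurePreserving.mono_left
    gauss_absolutelyContinuous

lemma quasiMeasurePreserving_toLp_gauss :
    Measure.QuasiMeasurePreserving (WithLp.toLp 2) (volume : Measure (Fin n → ℝ)) (gauss _) :=
  (PiLp.volume_preserving_toLp (Fin n)).quasiMeasurePreserving.mono_right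
    absolutelyContinuous_gauss

/-- The density of `f(𝐯) d𝐯` with respect to the Gaussian measure `e^{-π|𝐯|²} d𝐯`. -/
def relDensity (f : (Fin n → ℝ) → ℝ) (y : EuclideanSpace ℝ (Fin n)) : ℝ :=
  f y.ofLp / maxwellian y.ofLp

lemma maxwellian_mul_relDensity (f : (Fin n → ℝ) → ℝ) (x : Fin n → ℝ) :
    maxwellian x * relDensity f (WithLp.toLp 2 x) = f x :=
  mul_div_cancel₀ _ (maxwellian_pos x).ne'

lemma integrable_relDensity_iff : Integrable (relDensity f) (gauss _) ↔ Integrable f := by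
  rw [← integrable_maxwellian_mul_iff]
  simp only [maxwellian_mul_relDensity]

lemma integral_relDensity : ∫ y, relDensity f y ∂gauss _ = ∫ x, f x := by
  rw [← integral_maxwellian_mul]
  simp only [maxwellian_mul_relDensity]

lemma relDensity_nonneg_iff : 0 ≤ᵐ[gauss _] relDensity f ↔ 0 ≤ᵐ[volume] f := by
  refine ⟨fun h => (quasiMeasurePreserving_toLp_gauss.ae h).mono fun x hx => ?_,
    fun h => (quasiMeasurePreserving_ofLp_gauss.ae h).mono
      fun _ hy => div_nonneg hy (maxwellian_pos _).le⟩
  rw [← maxwellian_mul_relDensity f]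
  exact mul_nonneg (maxwellian_pos x).le hx

lemma mul_log_div_maxwellian (f : (Fin n → ℝ) → ℝ) (x : Fin n → ℝ) :
    f x * Real.log (f x / maxwellian x)
      = maxwellian x * klFun (relDensity f (WithLp.toLp 2 x)) + (f x - maxwellian x) := by
  have h_ne := (maxwellian_pos x).ne'
  rw [klFun_apply, relDensity]
  field_simp
  ring

lemma integral_maxwellian : ∫ x : Fin n → ℝ, maxwellian x = 1 := by
  simpa using integral_maxwellian_mul (n := n) fun _ => 1

lemma integrable_mul_log_iff (hf : Integrable f) :
    Integrable (fun x => f x * Real.log (f x / maxwellian x)) ↔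
      Integrable (fun y => klFun (relDensity f y)) (gauss _) := by
  simp only [mul_log_div_maxwellian]
  have h_sub : Integrable fun x => f x - maxwellian x := hf.sub (integrable_maxwellian n)
  exact (integrable_add_iff_integrable_left h_sub).trans
    (integrable_maxwellian_mul_iff (φ := fun y => klFun (relDensity f y)))

lemma integral_mul_log (hf : Integrable f) (hf_mass : ∫ x, f x = 1)
    (h_int : Integrable (fun y => klFun (relDensity f y)) (gauss _)) :
    ∫ x, f x * Real.log (f x / maxwellian x) = ∫ y, klFun (relDensity f y) ∂gauss _ := by
  simp only [mul_log_div_maxwellian]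
  have h_sub : Integrable fun x => f x - maxwellian x := hf.sub (integrable_maxwellian n)
  rw [integral_add (integrable_maxwellian_mul_iff.2 h_int) h_sub,
    integral_sub hf (integrable_maxwellian n), hf_mass, integral_maxwellian, sub_self, add_zero,
    integral_maxwellian_mul fun y => klFun (relDensity f y)]

lemma relEntropy_eq_klEntropy (hf : Integrable f) (hf_nonneg : ∀ᵐ x, 0 ≤ f x)
    (hf_mass : ∫ x, f x = 1) : relEntropy f = (klEntropy (gauss _) (relDensity f) : EReal) := by
  have h_nonneg : 0 ≤ᵐ[gauss _] fun y => klFun (relDensity f y) :=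
    (relDensity_nonneg_iff.2 hf_nonneg).mono fun y hy => klFun_nonneg hy
  have h_meas : AEStronglyMeasurable (fun y => klFun (relDensity f y)) (gauss _) :=
    continuous_klFun.comp_aestronglyMeasurable (integrable_relDensity_iff.2 hf).aestronglyMeasurable
  by_cases h_int : Integrable (fun y => klFun (relDensity f y)) (gauss _)
  · rw [relEntropy, if_pos ((integrable_mul_log_iff hf).2 h_int), integral_mul_log hf hf_mass h_int,
      klEntropy, ← ofReal_integral_eq_lintegral_ofReal h_int h_nonneg, EReal.coe_ennreal_ofReal,
      max_eq_left (integral_nonneg_of_ae h_nonneg)]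
  · have h_top : klEntropy (gauss _) (relDensity f) = ⊤ := by
      by_contra h_fin
      exact h_int ⟨h_meas, (hasFiniteIntegral_iff_ofReal h_nonneg).2 (lt_top_iff_ne_top.2 h_fin)⟩
    rw [relEntropy, if_neg (mt (integrable_mul_log_iff hf).1 h_int), h_top, EReal.coe_ennreal_top]

end RelativeEntropy

section Marginal

open ContinuousLinearMap (adjoint)
open scoped NNReal

variable {M N : ℕ}

/-- The isometry of the total space with the direct sum of system and reservoir. -/
abbrev particleSplit (M N : ℕ) : EuclideanSpace ℝ (Particle M N) ≃ₗᵢ[ℝ]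
    WithLp 2 (EuclideanSpace ℝ (Fin M) × EuclideanSpace ℝ (Fin N)) :=
  PiLp.sumPiLpEquivProdLpPiLp 2 fun _ => ℝ

lemma systemOutput_particleSplit (g : OrthGroup (Particle M N))
    (p : EuclideanSpace ℝ (Fin M) × EuclideanSpace ℝ (Fin N)) :
    systemOutput (particleSplit M N) g p
      = WithLp.toLp 2 fun i => (g • Sum.elim p.1.ofLp p.2.ofLp) (Sum.inl i) :=
  rfl

lemma integral_sq_norm_adjoint_systemBlock {lamS lamR mu t : ℝ} (ν : Measure ℝ)
    [IsProbabilityMeasure ν] (hlamS : 0 ≤ lamS) (hlamR : 0 ≤ lamR) (hmu : 0 ≤ mu) (ht : 0 ≤ t)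
    (hN : 1 ≤ N) (hν : ∫ θ, Real.sin θ * Real.cos θ ∂ν = 0) (ξ : EuclideanSpace ℝ (Fin M)) :
    ∫ g, ‖adjoint (systemBlock (particleSplit M N) g) ξ‖ ^ 2
        ∂compoundPoisson (kacIntensity M N lamS lamR mu ν t)
      = (M / (N + M) + N / (N + M)
        * Real.exp (-t * (mu * ∫ θ, Real.sin θ ^ 2 ∂ν) * (N + M) / N)) * ‖ξ‖ ^ 2 := by
  have h_coord (g : OrthGroup (Particle M N)) :
      ‖adjoint (systemBlock (particleSplit M N) g) ξ‖ ^ 2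
        = ∑ i, (g⁻¹ • (Sum.elim ξ.ofLp 0 : Particle M N → ℝ)) (Sum.inl i) ^ 2 := by
    rw [adjoint_systemBlock, EuclideanSpace.real_norm_sq_eq]
    rfl
  simp only [h_coord, EuclideanSpace.real_norm_sq_eq]
  exact integral_sum_sq_system_inv_smul ν hlamS hlamR hmu ht hN hν fun _ => rfl

lemma initialFun_smul (f : (Fin M → ℝ) → ℝ) (g : OrthGroup (Particle M N)) (v : Fin M → ℝ)
    (w : Fin N → ℝ) :
    initialFun f (g • Sum.elim v w) = maxwellian v * maxwellian w * relDensity f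
      (systemOutput (particleSplit M N) g (WithLp.toLp 2 v, WithLp.toLp 2 w)) := by
  have h_energy := sum_sq_smul g (Sum.elim v w)
  simp only [Fintype.sum_sum_type, Sum.elim_inl, Sum.elim_inr] at h_energy
  rw [initialFun, ← maxwellian_mul_relDensity f, systemOutput_particleSplit, mul_right_comm]
  congr 1
  simp only [maxwellian, ← Real.exp_add, ← mul_add, h_energy]

lemma ae_ae_sumElim {F : State M N} {G : (Particle M N → ℝ) → ℝ} (h : F =ᵐ[volume] G) :
    ∀ᵐ v : Fin M → ℝ, ∀ᵐ w : Fin N → ℝ, F (Sum.elim v w) = G (Sum.elim v w) :=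
  Measure.ae_ae_of_ae_prod ((volume_measurePreserving_sumPiEquivProdPi_symm
    fun _ : Particle M N => ℝ).quasiMeasurePreserving.ae h)

namespace IsGroupAverage

variable {ρ : Measure (OrthGroup (Particle M N))} {T : State M N →L[ℝ] State M N}
  {f : (Fin M → ℝ) → ℝ} {q : ℝ}

lemma initialState_ae_eq [SFinite ρ] (hT : IsGroupAverage ρ T) (hf : Integrable f) :
    T (initialState N f hf) =ᵐ[volume] fun x => ∫ g, initialFun f (g • x) ∂ρ := by
  filter_upwards [hT (initialState N f hf),
    ae_ae_smul ρ (integrable_initialFun N hf).coeFn_toL1] with x hx hx_smul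
  rw [hx]
  exact integral_congr_ae hx_smul

variable [IsProbabilityMeasure ρ]

lemma relDensity_marginal (hT : IsGroupAverage ρ T) (hf : Integrable f) :
    relDensity (marginal (T (initialState N f hf))) =ᵐ[gauss _]
      thermostat ρ (systemBlock (particleSplit M N)) (reservoirBlock (particleSplit M N))
        (relDensity f) := by
  have h_sections := ((isThermostat_blocks (particleSplit M N)).measurePreserving_affine
    (P := ρ)).integrable_comp_of_integrable (integrable_relDensity_iff.2 hf) |>.prod_right_ae
  filter_upwards [h_sections, quasiMeasurePreserving_ofLp_gauss.ae
    (ae_ae_sumElim (hT.initialState_ae_eq hf))] with v h_int hv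
  have h_marginal : marginal (T (initialState N f hf)) v.ofLp = maxwellian v.ofLp *
      ∫ w, ∫ g, relDensity f (systemOutput (particleSplit M N) g (v, w)) ∂ρ ∂gauss _ := by
    rw [marginal, integral_congr_ae hv, ← integral_maxwellian_mul, ← integral_const_mul]
    simp only [initialFun_smul, integral_const_mul, mul_assoc]
  simp only [Function.comp_def] at h_int
  rw [relDensity, h_marginal, mul_div_cancel_left₀ _ (maxwellian_pos _).ne', thermostat,
    integral_prod_symm _ h_int]
  simp only [systemBlock_add_reservoirBlock]

lemma integrable_marginal (hT : IsGroupAverage ρ T) (hf : Integrable f) :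
    Integrable (marginal (T (initialState N f hf))) :=
  integrable_relDensity_iff.1 (((isThermostat_blocks _).integrable_thermostat
    (integrable_relDensity_iff.2 hf)).congr (hT.relDensity_marginal hf).symm)

lemma integral_marginal (hT : IsGroupAverage ρ T) (hf : Integrable f) :
    ∫ v, marginal (T (initialState N f hf)) v = ∫ v, f v := by
  rw [← integral_relDensity, integral_congr_ae (hT.relDensity_marginal hf),
    (isThermostat_blocks _).integral_thermostat (integrable_relDensity_iff.2 hf),
    integral_relDensity]

lemma marginal_nonneg (hT : IsGroupAverage ρ T) (hf : Integrable f)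
    (hf_nonneg : 0 ≤ᵐ[volume] f) : 0 ≤ᵐ[volume] marginal (T (initialState N f hf)) :=
  relDensity_nonneg_iff.1 (((isThermostat_blocks _).thermostat_nonneg
    (relDensity_nonneg_iff.2 hf_nonneg)).trans_eq (hT.relDensity_marginal hf).symm)

lemma relEntropy_marginal_le (hT : IsGroupAverage ρ T) (hf : Integrable f)
    (hf_nonneg : 0 ≤ᵐ[volume] f) (hf_mass : ∫ v, f v = 1) (hq_nonneg : 0 ≤ q)
    (hq : ∀ ξ, ∫ g, ‖adjoint (systemBlock (particleSplit M N) g) ξ‖ ^ 2 ∂ρ = q * ‖ξ‖ ^ 2) :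
    relEntropy (marginal (T (initialState N f hf))) ≤ (q : EReal) * relEntropy f := by
  have h_le := (isThermostat_blocks _).klEntropy_thermostat_le (integrable_relDensity_iff.2 hf)
    (relDensity_nonneg_iff.2 hf_nonneg) hq
  rw [integral_relDensity, hf_mass, InformationTheory.klFun_one, mul_zero, ENNReal.ofReal_zero,
    add_zero, ← klEntropy_congr (hT.relDensity_marginal hf)] at h_le
  rw [relEntropy_eq_klEntropy hf hf_nonneg hf_mass,
    relEntropy_eq_klEntropy (hT.integrable_marginal hf) (hT.marginal_nonneg hf hf_nonneg)
      ((hT.integral_marginal hf).trans hf_mass)]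
  calc (klEntropy (gauss _) (relDensity (marginal (T (initialState N f hf)))) : EReal)
      ≤ (ENNReal.ofReal q * klEntropy (gauss _) (relDensity f) : ENNReal) :=
        EReal.coe_ennreal_le_coe_ennreal_iff.2 h_le
    _ = (q : EReal) * klEntropy (gauss _) (relDensity f) := by
        rw [EReal.coe_ennreal_mul, EReal.coe_ennreal_ofReal, max_eq_left hq_nonneg]

end IsGroupAverage

end Marginal

end Kac

end

theorem mainTheorem2 (M N : ℕ) (hM : 1 ≤ M) (hN : 1 ≤ N)
    (lamS lamR mu : ℝ) (hlamS : 0 ≤ lamS) (hlamR : 0 ≤ lamR) (hmu : 0 ≤ mu)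
    (ν : MeasureTheory.Measure ℝ) [MeasureTheory.IsProbabilityMeasure ν]
    (hsupp : ν (Set.Icc (-Real.pi) Real.pi)ᶜ = 0)
    (hν : ∫ θ, Real.sin θ * Real.cos θ ∂ν = 0)
    (f₀ : (Fin M → ℝ) → ℝ) (hf₀ : MeasureTheory.Integrable f₀)
    (hpos : ∀ᵐ v, 0 ≤ f₀ v) (hmass : ∫ v, f₀ v = 1)
    (t : ℝ) (ht : 0 ≤ t) :
    Kac.relEntropy
        (Kac.marginal (Kac.evolution M N lamS lamR mu ν t (Kac.initialState N f₀ hf₀))) ≤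
      (((M : ℝ) / (N + M) + (N : ℝ) / (N + M) *
          Real.exp (-t * (mu * ∫ θ, Real.sin θ ^ 2 ∂ν) * (N + M) / N) : ℝ) : EReal) *
        Kac.relEntropy f₀ :=
  (Kac.isGroupAverage_evolution ν hlamS hlamR hmu ht).relEntropy_marginal_le hf₀ hpos hmass
    (by positivity)
    (Kac.integral_sq_norm_adjoint_systemBlock ν hlamS hlamR hmu ht hN hν)
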